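/- A Krein space is a complex vector space $\mathcal H$ with a Hermitian sesquilinear form $[\cdot,\cdot]$ that admits a fundamental decomposition, i.e. a direct sum decomposition $\mathcal H=\mathcal H_+\dotplus\mathcal H_-$ with $[\mathcal H_+,\mathcal H_-]=0$ such that $(\mathcal H_+,[\cdot,\cdot])$ and $(\mathcal H_-,-[\cdot,\cdot])$ are Hilbert spaces. If $P_\pm$ are the projections onto $\mathcal H_\pm$ along $\mathcal H_\mp$, then $J=P_+-P_-$ is a signature operator, and $\langle x,y\rangle_J=[Jx,y]$ makes $\mathcal H$ a Hilbert space, denoted $\mathcal H_J$; its topology does not depend on $J$, and boundedness of operators and closedness of subspaces refer to it. Let $L(\mathcal H)^{[s]}$ be the set of bounded operators $T$ with $[Tx,y]=[x,Ty]$ for all $x,y$; for such operators $X\le Y$ means $[(Y-X)x,x]\ge 0$ for all $x$. For a subspace $\mathcal M$ put $\mathcal M^{[\perp]}=\{x:[x,m]=0\ \text{for all } m\in\mathcal M\}$, and for $W\in L(\mathcal H)^{[s]}$ put $$\mathcal N^-(W,\mathcal M^{[\perp]})=\{X\in L(\mathcal H)^{[s]}: X\le W,\ R(X)\subseteq\mathcal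 M^{[\perp]}\},\qquad \mathcal N^+(W,\mathcal M^{[\perp]})=\{X\in L(\mathcal H)^{[s]}: W\le X,\ R(X)\subseteq\mathcal M^{[\perp]}\}.$$ Maxima and minima of these sets are taken with respect to $\le$. Let $B$ be a bounded selfadjoint operator on a Hilbert space and $\mathcal S$ a closed subspace, and write $B=\begin{pmatrix}a&b\\ b^*&c\end{pmatrix}$ with respect to $\mathcal S\oplus\mathcal S^\perp$. Then $B$ is $\mathcal S$-weakly complementable if $R(b)\subseteq R(|a|^{1/2})$. In this case its Schur complement is $B_{/\mathcal S}=\begin{pmatrix}0&0\\0&c-f^*uf\end{pmatrix}$, where $f$ is the unique bounded solution of $b=|a|^{1/2}f$ with $N(f)=N(b)$ and $R(f)\subseteq\overline{R(|a|^{1/2})}$, and $a=u|a|$ is the polar decomposition, $u$ being the partial isometry with $N(u)=N(a)$. An operator $W\in L(\mathcal H)^{[s]}$ on a Krein space is $\mathcal S$-weakly complementable if $JW$ is $\mathcal S$-weakly complementable in $\mathcal H_J$ for some signature operator $J$. Theorem. Let $\mathcal H$ be a Krein space, $W\in L(\mathcal H)^{[s]}$ and $\mathcal S$ a closed subspace of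 $\mathcal H$. Let $\mathcal S=\mathcal S_+\dotplus\mathcal S_-$ be any decomposition into closed subspaces with $[Ws,t]=0$ for all $s\in\mathcal S_+$, $t\in\mathcal S_-$, with $[Ws,s]\ge0$ for $s\in\mathcal S_+$ and $[Ws,s]\le0$ for $s\in\mathcal S_-$, and such that $\mathcal S_+$ and $\mathcal S_-$ are orthogonal in $\mathcal H_J$ for some signature operator $J$. Then $W$ is $\mathcal S$-weakly complementable if and only if both $$\min\mathcal N^+\big(\max\mathcal N^-(W,\mathcal S_+^{[\perp]}),\mathcal S_-^{[\perp]}\big)\quad\text{and}\quad \max\mathcal N^-\big(\min\mathcal N^+(W,\mathcal S_-^{[\perp]}),\mathcal S_+^{[\perp]}\big)$$ exist (including the inner maximum and the inner minimum). In that case, for every signature operator $J'$, the operator $J'W$ is $\mathcal S$-weakly complementable in $\mathcal H_{J'}$, and both of these operators are equal to the Schur complement $W_{/[\mathcal S]}=J'\,(J'W)_{/\mathcal S}$, where $(J'W)_{/\mathcal S}$ is formed in $\mathcal H_{J'}$. -/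

import Mathlib

open scoped ComplexConjugate InnerProduct

noncomputable section

namespace KreinSchur

/-! ### Hilbert space operators: reduced solutions, polar decompositions, Schur complements -/

section Hilbert

variable {H H₁ H₂ : Type*}
  [NormedAddCommGroup H] [InnerProductSpace ℂ H] [CompleteSpace H]
  [NormedAddCommGroup H₁] [InnerProductSpace ℂ H₁] [CompleteSpace H₁]
  [NormedAddCommGroup H₂] [InnerProductSpace ℂ H₂] [CompleteSpace H₂]

/-- `D` is the reduced solution of `Z = Y X`: it solves the equation, `N(D) = N(Z)` and
`R(D) ⊆ closure R(Y*)`. -/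
structure IsReducedSolution (Z : H₂ →L[ℂ] H) (Y : H₁ →L[ℂ] H) (D : H₂ →L[ℂ] H₁) : Prop where
  eq : Z = Y ∘L D
  ker_eq : D.ker = Z.ker
  range_le : D.range ≤ (Y†).range.topologicalClosure

/-- Douglas' lemma: existence and uniqueness of the reduced solution. -/
theorem existsUnique_reducedSolution (Z : H₂ →L[ℂ] H) (Y : H₁ →L[ℂ] H)
    (h : Z.range ≤ Y.range) : ∃! D : H₂ →L[ℂ] H₁, IsReducedSolution Z Y D := by
  have hcl : (Y†).range.topologicalClosure = Y.kerᗮ := (Y.orthogonal_ker).symm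
  have hcompl : CompleteSpace Y.ker := Y.isClosed_ker.completeSpace_coe
  have hdis : ∀ x ∈ Y.kerᗮ, Y x = 0 → x = 0 := fun x hx h0 =>
    inner_self_eq_zero.1 ((Submodule.mem_orthogonal _ _).1 hx x h0)
  have hex : ∀ y : H₂, ∃ x ∈ Y.kerᗮ, Y x = Z y := by
    intro y
    obtain ⟨x, hx⟩ := h ⟨y, rfl⟩
    refine ⟨x - Y.ker.starProjection x, Submodule.sub_starProjection_mem_orthogonal x, ?_⟩
    have : Y (Y.ker.starProjection x) = 0 := Submodule.starProjection_apply_mem Y.ker x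
    rw [map_sub, this, sub_zero]
    exact hx
  choose d hd hYd using hex
  have huniq : ∀ y x, x ∈ Y.kerᗮ → Y x = Z y → x = d y := by
    intro y x hx hxy
    refine sub_eq_zero.1 (hdis _ (Submodule.sub_mem _ hx (hd y)) ?_)
    rw [map_sub, hxy, hYd, sub_self]
  let D₀ : H₂ →ₗ[ℂ] H₁ :=
    { toFun := d
      map_add' := fun a b => (huniq _ _ (Submodule.add_mem _ (hd a) (hd b))
        (by rw [map_add, map_add, hYd, hYd])).symm
      map_smul' := fun c a => (huniq _ _ (Submodule.smul_mem _ c (hd a))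
        (by simp [hYd])).symm }
  have hcont : Continuous D₀ := by
    refine D₀.continuous_of_seq_closed_graph fun u x y hu hy => ?_
    refine huniq x y ?_ ?_
    · exact (Submodule.isClosed_orthogonal _).mem_of_tendsto hy
        (Filter.Eventually.of_forall fun n => hd (u n))
    · have h1 := (Y.continuous.tendsto y).comp hy
      have h2 := (Z.continuous.tendsto x).comp hu
      refine tendsto_nhds_unique h1 (h2.congr fun n => (hYd (u n)).symm)
  refine ⟨⟨D₀, hcont⟩, ⟨?_, ?_, ?_⟩, ?_⟩
  · ext y
    exact (hYd y).symm
  · ext y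
    change d y = 0 ↔ Z y = 0
    constructor
    · intro h0
      rw [← hYd, h0, map_zero]
    · intro h0
      exact (huniq y 0 (Submodule.zero_mem _) (by rw [map_zero, h0])).symm
  · rw [hcl]
    rintro _ ⟨y, rfl⟩
    exact hd y
  · intro D' hD'
    ext y
    refine huniq y _ ?_ ?_
    · rw [← hcl]
      exact hD'.range_le ⟨y, rfl⟩
    · exact (congrArg (fun T => T y) hD'.eq).symm

/-- The reduced solution of `Z = Y X`, when `R(Z) ⊆ R(Y)`. -/
def reducedSolution (Z : H₂ →L[ℂ] H) (Y : H₁ →L[ℂ] H) (h : Z.range ≤ Y.range) :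
    H₂ →L[ℂ] H₁ :=
  (existsUnique_reducedSolution Z Y h).choose

/-- `T = U |T|` is the polar decomposition of `T`: `U` is a partial isometry, `N(U) = N(T)`. -/
structure IsPolarFactor (T U : H →L[ℂ] H) : Prop where
  eq : T = U ∘L CFC.abs T
  isometry_on : ∀ x ∈ U.kerᗮ, ‖U x‖ = ‖x‖
  ker_eq : U.ker = T.ker

/-- Existence and uniqueness of the polar decomposition. -/
theorem existsUnique_polarFactor (T : H →L[ℂ] H) : ∃! U : H →L[ℂ] H, IsPolarFactor T U := by
  set A : H →L[ℂ] H := CFC.abs T with hA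
  have hsa : A† = A := (IsSelfAdjoint.of_nonneg (CFC.abs_nonneg T)).star_eq
  have hAA : A ∘L A = T† ∘L T := CFC.abs_mul_abs T
  have hnorm : ∀ x, ‖A x‖ = ‖T x‖ := by
    intro x
    have h1 : inner ℂ (A x) (A x) = inner ℂ (T x) (T x) := by
      rw [← ContinuousLinearMap.adjoint_inner_right, ← ContinuousLinearMap.adjoint_inner_right,
        hsa]
      exact congrArg (fun S : H →L[ℂ] H => inner ℂ x (S x)) hAA
    rw [@norm_eq_sqrt_re_inner ℂ, @norm_eq_sqrt_re_inner ℂ, h1]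
  have hker : A.ker = T.ker := by
    ext x
    change A x = 0 ↔ T x = 0
    rw [← norm_eq_zero, hnorm, norm_eq_zero]
  have hperp : A.kerᗮ = A.range.topologicalClosure := by
    rw [A.orthogonal_ker, hsa]
  set M : Submodule ℂ H := A.range.topologicalClosure with hM
  have hMc : CompleteSpace M := A.range.isClosed_topologicalClosure.completeSpace_coe
  have hmem : ∀ x, A x ∈ M := fun x => A.range.le_topologicalClosure ⟨x, rfl⟩
  let e : H →ₗ[ℂ] M := (A : H →ₗ[ℂ] H).codRestrict M hmem
  have hdense : DenseRange e := by
    intro z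
    rw [closure_subtype]
    have : (Subtype.val '' Set.range e) = (A.range : Set H) := by
      ext w
      constructor
      · rintro ⟨_, ⟨x, rfl⟩, rfl⟩
        exact ⟨x, rfl⟩
      · rintro ⟨x, rfl⟩
        exact ⟨e x, ⟨x, rfl⟩, rfl⟩
    rw [this]
    exact z.2
  let U₀ : M →L[ℂ] H := (T : H →ₗ[ℂ] H).extendOfNorm e
  have hU₀ : ∀ x, U₀ (e x) = T x :=
    LinearMap.extendOfNorm_eq hdense ⟨1, fun x => by
      rw [one_mul]; exact (hnorm x).symm.le⟩
  have hiso : ∀ z : M, ‖U₀ z‖ = ‖z‖ := by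
    intro z
    refine hdense.induction ?_ (isClosed_eq (by fun_prop) (by fun_prop)) z
    rintro _ ⟨x, rfl⟩
    rw [hU₀]
    exact (hnorm x).symm
  have hUkey : ∀ U : H →L[ℂ] H, (∀ x, U x = U₀ (M.orthogonalProjectionOnto x)) →
      IsPolarFactor T U := by
    intro U hU
    have hkU : U.ker = A.ker := by
      ext x
      change U x = 0 ↔ _
      rw [hU, ← norm_eq_zero, hiso, norm_eq_zero,
        Submodule.orthogonalProjectionOnto_eq_zero_iff, ← hperp,
        Submodule.orthogonal_orthogonal_eq_closure,
        A.isClosed_ker.submodule_topologicalClosure_eq]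
    refine ⟨?_, ?_, hkU.trans hker⟩
    · ext x
      change T x = U (A x)
      rw [hU]
      have : M.orthogonalProjectionOnto (A x) = e x :=
        Submodule.orthogonalProjectionOnto_mem_subspace_eq_self (e x)
      rw [this, hU₀]
    · intro x hx
      rw [hkU, hperp] at hx
      rw [hU, hiso]
      have : M.orthogonalProjectionOnto x = ⟨x, hx⟩ :=
        Submodule.orthogonalProjectionOnto_mem_subspace_eq_self (⟨x, hx⟩ : M)
      rw [this]
      rfl
  refine ⟨U₀ ∘L M.orthogonalProjectionOnto, hUkey _ fun _ => rfl, ?_⟩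
  intro U hU
  ext x
  change U x = U₀ (M.orthogonalProjectionOnto x)
  have h1 : ∀ z : M, U z = U₀ z := by
    intro z
    refine hdense.induction ?_ (isClosed_eq (by fun_prop) (by fun_prop)) z
    rintro _ ⟨y, rfl⟩
    rw [hU₀]
    exact (congrArg (fun S : H →L[ℂ] H => S y) hU.eq).symm
  have h2 : U (x - M.orthogonalProjectionOnto x) = 0 := by
    have : x - M.orthogonalProjectionOnto x ∈ U.ker := by
      rw [hU.ker_eq, ← hker, ← A.isClosed_ker.submodule_topologicalClosure_eq,
        ← Submodule.orthogonal_orthogonal_eq_closure, hperp]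
      exact Submodule.sub_starProjection_mem_orthogonal x
    exact this
  rw [map_sub, sub_eq_zero] at h2
  rw [h2, h1]

/-- The partial isometry of the polar decomposition. -/
def polarFactor (T : H →L[ℂ] H) : H →L[ℂ] H :=
  (existsUnique_polarFactor T).choose

/-- The entry `a` of the block matrix of `B` with respect to `H = S ⊕ Sᗮ`. -/
def block11 (B : H →L[ℂ] H) (S : Submodule ℂ H) [CompleteSpace S] : S →L[ℂ] S :=
  S.orthogonalProjectionOnto ∘L B ∘L S.subtypeL

/-- The entry `b` of the block matrix of `B` with respect to `H = S ⊕ Sᗮ`. -/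
def block12 (B : H →L[ℂ] H) (S : Submodule ℂ H) [CompleteSpace S] : Sᗮ →L[ℂ] S :=
  S.orthogonalProjectionOnto ∘L B ∘L Sᗮ.subtypeL

/-- The entry `c` of the block matrix of `B` with respect to `H = S ⊕ Sᗮ`. -/
def block22 (B : H →L[ℂ] H) (S : Submodule ℂ H) [CompleteSpace S] : Sᗮ →L[ℂ] Sᗮ :=
  Sᗮ.orthogonalProjectionOnto ∘L B ∘L Sᗮ.subtypeL

/-- `|T|^{1/2}`. -/
def sqrtAbs (T : H →L[ℂ] H) : H →L[ℂ] H :=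
  CFC.sqrt (CFC.abs T)

/-- `B` is `S`-weakly complementable: `R(b) ⊆ R(|a|^{1/2})`. -/
def IsWeaklyCompl (B : H →L[ℂ] H) (S : Submodule ℂ H) [CompleteSpace S] : Prop :=
  (block12 B S).range ≤ (sqrtAbs (block11 B S)).range

/-- The Schur complement of `B` to `S`: the operator with the single nonzero block
`c - f* u f` on `Sᗮ`, where `f` is the reduced solution of `b = |a|^{1/2} x` and `a = u |a|` is
the polar decomposition of `a`. -/
def schurCompl (B : H →L[ℂ] H) (S : Submodule ℂ H) [CompleteSpace S]
    (h : IsWeaklyCompl B S) : H →L[ℂ] H :=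
  let f : Sᗮ →L[ℂ] S := reducedSolution (block12 B S) (sqrtAbs (block11 B S)) h
  let u : S →L[ℂ] S := polarFactor (block11 B S)
  Sᗮ.subtypeL ∘L (block22 B S - f† ∘L u ∘L f) ∘L Sᗮ.orthogonalProjectionOnto

end Hilbert

/-! ### Krein spaces -/

section Krein

variable {V : Type*} [AddCommGroup V] [Module ℂ V]

/-- The sesquilinear form `Φ` (conjugate-linear in the first variable, as Mathlib's inner products
are) turns `V` into a Hilbert space: it is Hermitian, positive definite and complete. -/
structure IsHilbertForm (Φ : V →ₗ⋆[ℂ] V →ₗ[ℂ] ℂ) : Prop where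
  hermitian : ∀ x y, conj (Φ x y) = Φ y x
  pos : ∀ x, x ≠ 0 → 0 < (Φ x x).re
  complete : ∀ u : ℕ → V,
    (∀ ε > 0, ∃ N, ∀ m ≥ N, ∀ n ≥ N, (Φ (u m - u n) (u m - u n)).re < ε) →
    ∃ x, ∀ ε > 0, ∃ N, ∀ n ≥ N, (Φ (u n - x) (u n - x)).re < ε

variable (V) in
/-- An indefinite metric on `V`: a Hermitian sesquilinear form. -/
structure IndefiniteMetric where
  form : V →ₗ⋆[ℂ] V →ₗ[ℂ] ℂ
  hermitian : ∀ x y, conj (form x y) = form y x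

/-- A fundamental decomposition `V = V₊ [∔] V₋`, where `(V₊, [·,·])` and `(V₋, -[·,·])` are
Hilbert spaces. -/
structure FundamentalDecomposition (K : IndefiniteMetric V) where
  pos : Submodule ℂ V
  neg : Submodule ℂ V
  isCompl : IsCompl pos neg
  orthogonal : ∀ x ∈ pos, ∀ y ∈ neg, K.form x y = 0
  hilbert_pos : IsHilbertForm (K.form.domRestrict₁₂ pos pos)
  hilbert_neg : IsHilbertForm (-K.form.domRestrict₁₂ neg neg)

variable (V) in
/-- A Krein space structure on `V`. -/
structure KreinSpace extends IndefiniteMetric V where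
  exists_decomposition : Nonempty (FundamentalDecomposition toIndefiniteMetric)

namespace FundamentalDecomposition

variable {K : IndefiniteMetric V} (D : FundamentalDecomposition K)

/-- The projection `P₊` onto `V₊` along `V₋`. -/
def projPos : V →ₗ[ℂ] V := D.pos.projection D.neg D.isCompl

/-- The projection `P₋` onto `V₋` along `V₊`. -/
def projNeg : V →ₗ[ℂ] V := D.neg.projection D.pos D.isCompl.symm

/-- The signature operator `J = P₊ - P₋`. -/
def signature : V →ₗ[ℂ] V := D.projPos - D.projNeg

/-- The inner product `⟨x, y⟩ = [J x, y]`. -/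
def innerForm : V →ₗ⋆[ℂ] V →ₗ[ℂ] ℂ := K.form.comp D.signature

theorem projPos_mem (x : V) : D.projPos x ∈ D.pos := Submodule.projection_apply_mem _ _

theorem projNeg_mem (x : V) : D.projNeg x ∈ D.neg := Submodule.projection_apply_mem _ _

theorem projPos_add_projNeg (x : V) : D.projPos x + D.projNeg x = x :=
  Submodule.projection_add_projection_eq_self D.isCompl x

theorem projPos_of_mem_pos {x : V} (hx : x ∈ D.pos) : D.projPos x = x :=
  Submodule.projection_apply_of_mem_left D.isCompl hx

theorem projPos_of_mem_neg {x : V} (hx : x ∈ D.neg) : D.projPos x = 0 :=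
  (Submodule.projection_apply_eq_zero_iff D.isCompl).2 hx

theorem projNeg_of_mem_neg {x : V} (hx : x ∈ D.neg) : D.projNeg x = x :=
  Submodule.projection_apply_of_mem_left D.isCompl.symm hx

theorem projNeg_of_mem_pos {x : V} (hx : x ∈ D.pos) : D.projNeg x = 0 :=
  (Submodule.projection_apply_eq_zero_iff D.isCompl.symm).2 hx

theorem orthogonal' {x y : V} (hx : x ∈ D.neg) (hy : y ∈ D.pos) : K.form x y = 0 := by
  rw [← K.hermitian, D.orthogonal y hy x hx, map_zero]

theorem innerForm_apply (x y : V) : D.innerForm x y =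
    K.form (D.projPos x) (D.projPos y) - K.form (D.projNeg x) (D.projNeg y) := by
  have h1 : D.innerForm x y = K.form (D.projPos x - D.projNeg x) y := rfl
  have h2 := D.orthogonal _ (D.projPos_mem x) _ (D.projNeg_mem y)
  have h3 := D.orthogonal' (D.projNeg_mem x) (D.projPos_mem y)
  rw [h1]
  conv_lhs => rw [← D.projPos_add_projNeg y]
  simp only [map_sub, map_add, LinearMap.sub_apply, h2, h3]
  ring

theorem re_pos_nonneg {x : V} (hx : x ∈ D.pos) : 0 ≤ (K.form x x).re := by
  by_cases h : x = 0
  · simp [h]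
  · exact (D.hilbert_pos.pos ⟨x, hx⟩ fun h' => h (congrArg Subtype.val h')).le

theorem re_neg_nonneg {x : V} (hx : x ∈ D.neg) : 0 ≤ -(K.form x x).re := by
  by_cases h : x = 0
  · simp [h]
  · exact (D.hilbert_neg.pos ⟨x, hx⟩ fun h' => h (congrArg Subtype.val h')).le

/-- `(V, ⟨·,·⟩)` is a Hilbert space. -/
theorem isHilbertForm_innerForm : IsHilbertForm D.innerForm where
  hermitian x y := by
    rw [innerForm_apply, innerForm_apply, map_sub, K.hermitian, K.hermitian]
  pos x hx := by
    rw [innerForm_apply, Complex.sub_re]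
    have h1 := D.re_pos_nonneg (D.projPos_mem x)
    have h2 := D.re_neg_nonneg (D.projNeg_mem x)
    by_cases hp : D.projPos x = 0
    · have hn : D.projNeg x ≠ 0 := fun hn => hx (by
        rw [← D.projPos_add_projNeg x, hp, hn, add_zero])
      have : 0 < -(K.form (D.projNeg x) (D.projNeg x)).re :=
        D.hilbert_neg.pos ⟨_, D.projNeg_mem x⟩ fun h' => hn (congrArg Subtype.val h')
      linarith
    · have : 0 < (K.form (D.projPos x) (D.projPos x)).re :=
        D.hilbert_pos.pos ⟨_, D.projPos_mem x⟩ fun h' => hp (congrArg Subtype.val h')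
      linarith
  complete u hu := by
    obtain ⟨x, hx⟩ := D.hilbert_pos.complete (fun n => ⟨_, D.projPos_mem (u n)⟩) (by
      intro ε hε
      obtain ⟨N, hN⟩ := hu ε hε
      refine ⟨N, fun m hm n hn => lt_of_le_of_lt ?_ (hN m hm n hn)⟩
      have h2 := D.re_neg_nonneg (D.projNeg_mem (u m - u n))
      rw [innerForm_apply, Complex.sub_re, map_sub D.projPos]
      change (K.form (D.projPos (u m) - D.projPos (u n))
        (D.projPos (u m) - D.projPos (u n))).re ≤ _
      linarith)
    obtain ⟨y, hy⟩ := D.hilbert_neg.complete (fun n => ⟨_, D.projNeg_mem (u n)⟩) (by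
      intro ε hε
      obtain ⟨N, hN⟩ := hu ε hε
      refine ⟨N, fun m hm n hn => lt_of_le_of_lt ?_ (hN m hm n hn)⟩
      have h2 := D.re_pos_nonneg (D.projPos_mem (u m - u n))
      rw [innerForm_apply, Complex.sub_re, map_sub D.projNeg]
      change -(K.form (D.projNeg (u m) - D.projNeg (u n))
        (D.projNeg (u m) - D.projNeg (u n))).re ≤ _
      linarith)
    refine ⟨x + y, fun ε hε => ?_⟩
    obtain ⟨N₁, h₁⟩ := hx (ε / 2) (half_pos hε)
    obtain ⟨N₂, h₂⟩ := hy (ε / 2) (half_pos hε)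
    refine ⟨max N₁ N₂, fun n hn => ?_⟩
    have e₁ : (K.form (D.projPos (u n) - x) (D.projPos (u n) - x)).re < ε / 2 :=
      h₁ n (le_of_max_le_left hn)
    have e₂ : -(K.form (D.projNeg (u n) - y) (D.projNeg (u n) - y)).re < ε / 2 :=
      h₂ n (le_of_max_le_right hn)
    rw [innerForm_apply, Complex.sub_re]
    simp only [map_sub D.projPos, map_sub D.projNeg, map_add D.projPos, map_add D.projNeg,
      D.projPos_of_mem_pos x.2, D.projPos_of_mem_neg y.2, D.projNeg_of_mem_pos x.2,
      D.projNeg_of_mem_neg y.2, add_zero, zero_add]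
    linarith

/-- A copy of `V`, carrying the Hilbert space structure associated with the decomposition. -/
def Space (_D : FundamentalDecomposition K) : Type _ := V

instance : AddCommGroup D.Space := inferInstanceAs (AddCommGroup V)

instance : Module ℂ D.Space := inferInstanceAs (Module ℂ V)

/-- The identity map from `V` to its copy. -/
def toSpace : V ≃ₗ[ℂ] D.Space := LinearEquiv.refl ℂ V

/-- The inner product `⟨x, y⟩ = [J x, y]`, on the copy of `V`. -/
@[reducible]
def core : InnerProductSpace.Core ℂ D.Space where
  inner x y := D.innerForm (D.toSpace.symm x) (D.toSpace.symm y)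
  conj_inner_symm x y := D.isHilbertForm_innerForm.hermitian _ _
  re_inner_nonneg x := by
    by_cases h : D.toSpace.symm x = 0
    · rw [h]
      simp
    · exact (D.isHilbertForm_innerForm.pos _ h).le
  add_left x y z := by simp
  smul_left x y r := by simp
  definite x hx := by
    by_contra h
    have h' : D.toSpace.symm x ≠ 0 := fun h0 => h (D.toSpace.symm.map_eq_zero_iff.1 h0)
    have := D.isHilbertForm_innerForm.pos _ h'
    rw [hx] at this
    simp at this

instance : NormedAddCommGroup D.Space := D.core.toNormedAddCommGroup

instance : InnerProductSpace ℂ D.Space := InnerProductSpace.ofCore D.core.toCore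

theorem inner_toSpace (x y : V) :
    inner ℂ (D.toSpace x) (D.toSpace y) = K.form (D.signature x) y := rfl

theorem norm_sq_eq (x : D.Space) :
    ‖x‖ ^ 2 = (D.innerForm (D.toSpace.symm x) (D.toSpace.symm x)).re :=
  InnerProductSpace.norm_sq_eq_re_inner (𝕜 := ℂ) x

instance : CompleteSpace D.Space := by
  refine Metric.complete_of_cauchySeq_tendsto fun u hu => ?_
  rw [Metric.cauchySeq_iff] at hu
  obtain ⟨x, hx⟩ := D.isHilbertForm_innerForm.complete (fun n => D.toSpace.symm (u n)) (by
    intro ε hε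
    obtain ⟨N, hN⟩ := hu (Real.sqrt ε) (Real.sqrt_pos.2 hε)
    refine ⟨N, fun m hm n hn => ?_⟩
    have h1 := hN m hm n hn
    rw [dist_eq_norm, Real.lt_sqrt (norm_nonneg _), norm_sq_eq, map_sub] at h1
    exact h1)
  refine ⟨D.toSpace x, Metric.tendsto_atTop.2 fun ε hε => ?_⟩
  obtain ⟨N, hN⟩ := hx (ε ^ 2) (by positivity)
  refine ⟨N, fun n hn => ?_⟩
  have h1 := hN n hn
  rw [dist_eq_norm]
  refine lt_of_pow_lt_pow_left₀ 2 hε.le ?_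
  rw [norm_sq_eq, map_sub, LinearEquiv.symm_apply_apply]
  exact h1

/-- A subspace of `V`, as a subspace of the associated Hilbert space. -/
def sub (S : Submodule ℂ V) : Submodule ℂ D.Space := S.map (D.toSpace : V →ₗ[ℂ] D.Space)

/-- A linear operator on `V`, as an operator on the associated Hilbert space. -/
def op (T : V →ₗ[ℂ] V) : D.Space →ₗ[ℂ] D.Space :=
  (D.toSpace : V →ₗ[ℂ] D.Space) ∘ₗ T ∘ₗ (D.toSpace.symm : D.Space →ₗ[ℂ] V)

theorem signature_signature (x : V) : D.signature (D.signature x) = x := by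
  change D.projPos (D.projPos x - D.projNeg x) - D.projNeg (D.projPos x - D.projNeg x) = x
  rw [map_sub, map_sub, D.projPos_of_mem_pos (D.projPos_mem x),
    D.projPos_of_mem_neg (D.projNeg_mem x), D.projNeg_of_mem_pos (D.projPos_mem x),
    D.projNeg_of_mem_neg (D.projNeg_mem x), sub_zero, zero_sub, sub_neg_eq_add,
    D.projPos_add_projNeg]

theorem norm_signature (x : V) : ‖D.toSpace (D.signature x)‖ = ‖D.toSpace x‖ := by
  have h : inner ℂ (D.toSpace (D.signature x)) (D.toSpace (D.signature x)) =
      inner ℂ (D.toSpace x) (D.toSpace x) := by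
    rw [inner_toSpace, inner_toSpace, signature_signature, ← K.hermitian]
    have := inner_conj_symm (𝕜 := ℂ) (D.toSpace x) (D.toSpace x)
    rwa [inner_toSpace] at this
  rw [@norm_eq_sqrt_re_inner ℂ, @norm_eq_sqrt_re_inner ℂ, h]

theorem form_eq_inner (x y : V) :
    K.form x y = inner ℂ (D.toSpace (D.signature x)) (D.toSpace y) := by
  rw [inner_toSpace, signature_signature]

theorem continuous_signature : Continuous (D.op D.signature) :=
  AddMonoidHomClass.continuous_of_bound (D.op D.signature) 1 fun x => by
    rw [one_mul]
    exact (D.norm_signature (D.toSpace.symm x)).le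

theorem form_eq_inner' (x y : V) :
    K.form x y = inner ℂ (D.toSpace x) (D.toSpace (D.signature y)) := by
  rw [← K.hermitian, form_eq_inner, inner_conj_symm]

/-- The topologies of the Hilbert spaces associated with two fundamental decompositions agree. -/
theorem continuous_change (D' : FundamentalDecomposition K) :
    Continuous (fun x : D.Space => D'.toSpace (D.toSpace.symm x)) := by
  let g : D.Space →ₗ[ℂ] D'.Space :=
    (D'.toSpace : V →ₗ[ℂ] D'.Space) ∘ₗ (D.toSpace.symm : D.Space →ₗ[ℂ] V)
  change Continuous g
  refine g.continuous_of_seq_closed_graph fun u x y hu hy => ?_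
  have key : ∀ z : V, K.form (D.toSpace.symm x) z = K.form (D'.toSpace.symm y) z := by
    intro z
    have h1 : Filter.Tendsto (fun n => inner ℂ (u n) (D.toSpace (D.signature z))) Filter.atTop
        (nhds (inner ℂ x (D.toSpace (D.signature z)))) := hu.inner tendsto_const_nhds
    have h2 : Filter.Tendsto (fun n => inner ℂ (g (u n)) (D'.toSpace (D'.signature z)))
        Filter.atTop (nhds (inner ℂ y (D'.toSpace (D'.signature z)))) :=
      hy.inner tendsto_const_nhds
    rw [D.form_eq_inner', D'.form_eq_inner', LinearEquiv.apply_symm_apply,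
      LinearEquiv.apply_symm_apply]
    refine tendsto_nhds_unique h1 (h2.congr fun n => ?_)
    have e1 : inner ℂ (g (u n)) (D'.toSpace (D'.signature z)) =
      K.form (D.toSpace.symm (u n)) z := (D'.form_eq_inner' _ _).symm
    rw [e1, D.form_eq_inner', LinearEquiv.apply_symm_apply]
  have h0 : g x - y = 0 := by
    rw [← inner_self_eq_zero (𝕜 := ℂ)]
    have : K.form (D.toSpace.symm x - D'.toSpace.symm y)
        (D'.signature (D.toSpace.symm x - D'.toSpace.symm y)) = 0 := by
      rw [map_sub, LinearMap.sub_apply, key, sub_self]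
    rw [D'.form_eq_inner', signature_signature] at this
    simpa [g] using this
  exact (sub_eq_zero.1 h0).symm

end FundamentalDecomposition

namespace KreinSpace

variable (K : KreinSpace V)

/-- The signature operators of `K` correspond to its fundamental decompositions. -/
abbrev Decomposition : Type _ := FundamentalDecomposition K.toIndefiniteMetric

/-- `S` is closed (in an associated Hilbert space). -/
def IsClosedSubspace (S : Submodule ℂ V) : Prop :=
  ∃ D : K.Decomposition, IsClosed (D.sub S : Set D.Space)

/-- `T` is bounded (in an associated Hilbert space). -/
def IsBounded (T : V →ₗ[ℂ] V) : Prop :=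
  ∃ D : K.Decomposition, Continuous (D.op T)

/-- `T` is a bounded selfadjoint operator: `T ∈ L(H)` and `[T x, y] = [x, T y]`. -/
structure IsBoundedSelfAdjoint (T : V →ₗ[ℂ] V) : Prop where
  bounded : K.IsBounded T
  selfAdjoint : ∀ x y, K.form (T x) y = K.form x (T y)

/-- The order `X ≤ Y`: the operator `Y - X` is positive. -/
structure OpLE (X Y : V →ₗ[ℂ] V) : Prop where
  isBoundedSelfAdjoint : K.IsBoundedSelfAdjoint (Y - X)
  nonneg : ∀ x, 0 ≤ (K.form ((Y - X) x) x).re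

/-- The orthogonal companion `S^[⊥]`. -/
def companion (S : Submodule ℂ V) : Submodule ℂ V where
  carrier := {x | ∀ s ∈ S, K.form x s = 0}
  zero_mem' := by simp
  add_mem' hx hy s hs := by simp [hx s hs, hy s hs]
  smul_mem' c x hx s hs := by simp [hx s hs]

/-- `N⁻(W, M)`, for a subspace `M`. -/
def lowerSet (W : V →ₗ[ℂ] V) (M : Submodule ℂ V) : Set (V →ₗ[ℂ] V) :=
  {X | K.IsBoundedSelfAdjoint X ∧ K.OpLE X W ∧ LinearMap.range X ≤ M}

/-- `N⁺(W, M)`, for a subspace `M`. -/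
def upperSet (W : V →ₗ[ℂ] V) (M : Submodule ℂ V) : Set (V →ₗ[ℂ] V) :=
  {X | K.IsBoundedSelfAdjoint X ∧ K.OpLE W X ∧ LinearMap.range X ≤ M}

/-- `X = max N`. -/
def IsMaximum (N : Set (V →ₗ[ℂ] V)) (X : V →ₗ[ℂ] V) : Prop :=
  X ∈ N ∧ ∀ Y ∈ N, K.OpLE Y X

/-- `X = min N`. -/
def IsMinimum (N : Set (V →ₗ[ℂ] V)) (X : V →ₗ[ℂ] V) : Prop :=
  X ∈ N ∧ ∀ Y ∈ N, K.OpLE X Y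

/-- `T = min N⁺(max N⁻(W, S₊^[⊥]), S₋^[⊥])`. -/
def IsMinMax (W : V →ₗ[ℂ] V) (Sp Sm : Submodule ℂ V) (T : V →ₗ[ℂ] V) : Prop :=
  ∃ M, K.IsMaximum (K.lowerSet W (K.companion Sp)) M ∧
    K.IsMinimum (K.upperSet M (K.companion Sm)) T

/-- `T = max N⁻(min N⁺(W, S₋^[⊥]), S₊^[⊥])`. -/
def IsMaxMin (W : V →ₗ[ℂ] V) (Sp Sm : Submodule ℂ V) (T : V →ₗ[ℂ] V) : Prop :=
  ∃ M, K.IsMinimum (K.upperSet W (K.companion Sm)) M ∧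
    K.IsMaximum (K.lowerSet M (K.companion Sp)) T

/-- A decomposition `S = S₊ [∔]_W S₋` into closed subspaces, `S₊` being `W`-nonnegative, `S₋`
being `W`-nonpositive, and `S₊ ⟂ S₋` for the inner product of the fundamental decomposition `D`. -/
structure IsSignDecomposition (D : K.Decomposition) (W : V →ₗ[ℂ] V)
    (S Sp Sm : Submodule ℂ V) : Prop where
  sup_eq : Sp ⊔ Sm = S
  disjoint : Disjoint Sp Sm
  closed_pos : K.IsClosedSubspace Sp
  closed_neg : K.IsClosedSubspace Sm
  form_eq_zero : ∀ s ∈ Sp, ∀ t ∈ Sm, K.form (W s) t = 0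
  nonneg : ∀ s ∈ Sp, 0 ≤ (K.form (W s) s).re
  nonpos : ∀ s ∈ Sm, (K.form (W s) s).re ≤ 0
  orthogonal : D.sub Sp ⟂ D.sub Sm

variable {K}

theorem IsClosedSubspace.isClosed {S : Submodule ℂ V} (hS : K.IsClosedSubspace S)
    (D : K.Decomposition) : IsClosed (D.sub S : Set D.Space) := by
  obtain ⟨D', h⟩ := hS
  convert h.preimage (D.continuous_change D') using 1
  ext x
  constructor
  · rintro ⟨v, hv, rfl⟩
    exact ⟨v, hv, rfl⟩
  · rintro ⟨v, hv, hx⟩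
    exact ⟨v, hv, congrArg (fun w => D.toSpace (D'.toSpace.symm w)) hx⟩

theorem IsBounded.continuous {T : V →ₗ[ℂ] V} (hT : K.IsBounded T) (D : K.Decomposition) :
    Continuous (D.op T) := by
  obtain ⟨D', h⟩ := hT
  exact (D'.continuous_change D).comp (h.comp (D.continuous_change D'))

/-- The operator `J W` on the Hilbert space associated with a fundamental decomposition. -/
def signatureMul (D : K.Decomposition) {W : V →ₗ[ℂ] V} (hW : K.IsBoundedSelfAdjoint W) :
    D.Space →L[ℂ] D.Space where
  toLinearMap := D.op (D.signature ∘ₗ W)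
  cont := D.continuous_signature.comp (hW.bounded.continuous D)

/-- `W` is `S`-weakly complementable with respect to a signature operator `J`: the operator `J W`
is `S`-weakly complementable in the associated Hilbert space. -/
def IsWeaklyComplFor (D : K.Decomposition) {W : V →ₗ[ℂ] V} (hW : K.IsBoundedSelfAdjoint W)
    {S : Submodule ℂ V} (hS : K.IsClosedSubspace S) : Prop :=
  haveI : CompleteSpace (D.sub S) := (hS.isClosed D).completeSpace_coe
  KreinSchur.IsWeaklyCompl (signatureMul D hW) (D.sub S)

/-- `W` is `S`-weakly complementable: it is so with respect to some signature operator. -/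
def IsWeaklyCompl {W : V →ₗ[ℂ] V} (hW : K.IsBoundedSelfAdjoint W)
    {S : Submodule ℂ V} (hS : K.IsClosedSubspace S) : Prop :=
  ∃ D : K.Decomposition, IsWeaklyComplFor D hW hS

/-- The Schur complement of `W` to `S` corresponding to a signature operator `J`, that is,
`J (J W)_{/S}`. -/
def schurComplFor (D : K.Decomposition) {W : V →ₗ[ℂ] V} (hW : K.IsBoundedSelfAdjoint W)
    {S : Submodule ℂ V} (hS : K.IsClosedSubspace S) (h : IsWeaklyComplFor D hW hS) :
    V →ₗ[ℂ] V :=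
  haveI : CompleteSpace (D.sub S) := (hS.isClosed D).completeSpace_coe
  D.signature ∘ₗ (D.toSpace.symm : D.Space →ₗ[ℂ] V) ∘ₗ
    (KreinSchur.schurCompl (signatureMul D hW) (D.sub S) h : D.Space →ₗ[ℂ] D.Space) ∘ₗ
    (D.toSpace : V →ₗ[ℂ] D.Space)

end KreinSpace

end Krein

end KreinSchur

end

open scoped ComplexConjugate InnerProduct

noncomputable section

namespace KreinSchur

/-! ### Range inclusion, square roots and polar decompositions in a Hilbert space. -/

section Hilbert

variable {E F G : Type*}
  [NormedAddCommGroup E] [InnerProductSpace ℂ E] [CompleteSpace E]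
  [NormedAddCommGroup F] [InnerProductSpace ℂ F] [CompleteSpace F]
  [NormedAddCommGroup G] [InnerProductSpace ℂ G] [CompleteSpace G]

/-! Both sides of the equivalence reduce to one condition that mentions neither operator square
roots nor, up to constants, the signature operator: `|[Wx, m]|² ≤ C ‖x‖² [Wm, m]` for `m` in `S₊`,
and the same for `-W` on `S₋` (`FormBound`).

Weak complementability says, by Douglas' criterion, that `⟨Bx, s⟩` is bounded by `‖x‖ ‖|a|^{1/2} s‖`
(`isWeaklyCompl_iff`, with `B = JW`). To pass to `FormBound` one needs the form of `|a|` to be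
equivalent to `[Wp, p] - [Wq, q]` at `p + q`, although the given decomposition need not be the
spectral one. If `σ` is the difference of the projections onto the two summands, then `aσ = σ*a` is
positive and `σ² = 1`, so `‖aσz‖` and `‖|a|z‖` dominate each other up to a constant; operator
monotonicity of the square root turns this into domination of forms (`exists_abs_equiv`). Since all
the Hilbert norms are equivalent, independence of `J` follows.

The inner extrema force the form bounds: if `X ≤ W` has range in `S₊^[⊥]`, then `X` is invisible on
`S₊`, and Cauchy–Schwarz for the positive operator `W - X` is the bound
(`formBound_of_mem_lowerSet`).

Conversely, the Schur complement `T` is approached along approximate saddle points: there are `s n`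
in `S₊`, `t n` in `S₋` of bounded energy such that `W(x - s n - t n)` is asymptotically zero against
`S₊` and `S₋` and tends weakly to `Tx` (`IsSchurLimit`). This notion does not involve `J`, and it
alone yields selfadjointness, the range conditions and extremality (`IsSchurLimit.isMaximum`,
`IsSchurLimit.isMinMax`); the inner maximum is the Schur complement to `S₊`. The max-min statement
is the min-max statement for `-W` with `S₊` and `S₋` interchanged. -/

/-- Douglas' majorization criterion for range inclusion. -/
theorem range_le_of_norm_adjoint_le (Z : F →L[ℂ] E) (Y : G →L[ℂ] E) (C : ℝ)
    (h : ∀ x, ‖(Z†) x‖ ≤ C * ‖(Y†) x‖) : Z.range ≤ Y.range := by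
  set M : Submodule ℂ G := (Y†).range.topologicalClosure with hM
  have hMc : CompleteSpace M := (Y†).range.isClosed_topologicalClosure.completeSpace_coe
  have hmem : ∀ x, (Y†) x ∈ M := fun x => (Y†).range.le_topologicalClosure ⟨x, rfl⟩
  let e : E →ₗ[ℂ] M := ((Y†) : E →ₗ[ℂ] G).codRestrict M hmem
  have hdense : DenseRange e := by
    intro z
    rw [closure_subtype]
    have : (Subtype.val '' Set.range e) = ((Y†).range : Set G) := by
      ext w
      constructor
      · rintro ⟨_, ⟨x, rfl⟩, rfl⟩
        exact ⟨x, rfl⟩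
      · rintro ⟨x, rfl⟩
        exact ⟨e x, ⟨x, rfl⟩, rfl⟩
    rw [this]
    exact z.2
  let U₀ : M →L[ℂ] F := ((Z†) : E →ₗ[ℂ] F).extendOfNorm e
  have hU₀ : ∀ x, U₀ (e x) = (Z†) x := LinearMap.extendOfNorm_eq hdense ⟨C, h⟩
  rintro _ ⟨x, rfl⟩
  -- The bound makes `Y* x ↦ Z* x` a bounded map on the closure of `R(Y*)`. Extended by zero to `G`,
  -- it satisfies `U Y* = Z*`, and taking adjoints gives `Z = Y U*`.
  refine ⟨((U₀ ∘L M.orthogonalProjectionOnto)†) x, ?_⟩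
  refine ext_inner_right ℂ fun y => ?_
  change inner ℂ (Y _) y = inner ℂ (Z x) y
  rw [← ContinuousLinearMap.adjoint_inner_right, ContinuousLinearMap.adjoint_inner_left,
    ← ContinuousLinearMap.adjoint_inner_right Z]
  have : M.orthogonalProjectionOnto ((Y†) y) = e y :=
    Submodule.orthogonalProjectionOnto_mem_subspace_eq_self (e y)
  rw [ContinuousLinearMap.comp_apply, this, hU₀]

/-- For positive operators, norm domination implies domination of the quadratic forms. -/
theorem re_inner_le_of_norm_le {M N : E →L[ℂ] E} (hM : M.IsPositive) (hN : N.IsPositive)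
    {C : ℝ} (hC : 0 ≤ C) (h : ∀ x, ‖M x‖ ≤ C * ‖N x‖) (x : E) :
    (inner ℂ (M x) x).re ≤ C * (inner ℂ (N x) x).re := by
  have hM0 : 0 ≤ M := (ContinuousLinearMap.nonneg_iff_isPositive M).2 hM
  have hCN : ((C : ℂ) • N).IsPositive := hN.smul_of_nonneg (by exact_mod_cast hC)
  have hCN0 : 0 ≤ (C : ℂ) • N := (ContinuousLinearMap.nonneg_iff_isPositive _).2 hCN
  have hsq : M * M ≤ ((C : ℂ) • N) * ((C : ℂ) • N) := by
    rw [ContinuousLinearMap.le_def, ContinuousLinearMap.isPositive_iff_complex]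
    intro y
    have key : inner ℂ ((((C : ℂ) • N) * ((C : ℂ) • N) - M * M) y) y =
        (((C * ‖N y‖) ^ 2 - ‖M y‖ ^ 2 : ℝ) : ℂ) := by
      have h1 : inner ℂ (M (M y)) y = ((‖M y‖ ^ 2 : ℝ) : ℂ) := by
        rw [hM.inner_left_eq_inner_right, inner_self_eq_norm_sq_to_K]; push_cast; rfl
      have h2 : inner ℂ (((C : ℂ) • N) (((C : ℂ) • N) y)) y = (((C * ‖N y‖) ^ 2 : ℝ) : ℂ) := by
        rw [hCN.inner_left_eq_inner_right, inner_self_eq_norm_sq_to_K,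
          _root_.smul_apply, norm_smul, Complex.norm_real, Real.norm_of_nonneg hC]
        push_cast; rfl
      rw [_root_.sub_apply, inner_sub_left]
      change inner ℂ (((C : ℂ) • N) (((C : ℂ) • N) y)) y - inner ℂ (M (M y)) y = _
      rw [h1, h2]; push_cast; ring
    rw [key]
    refine ⟨by rw [RCLike.re_to_complex, Complex.ofReal_re], ?_⟩
    change 0 ≤ (((C * ‖N y‖) ^ 2 - ‖M y‖ ^ 2 : ℝ) : ℂ).re
    rw [Complex.ofReal_re]
    nlinarith [h y, norm_nonneg (M y)]
  -- The norm bound says `M² ≤ (CN)²`; operator monotonicity of the square root gives `M ≤ CN`.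
  have hle := CFC.sqrt_le_sqrt _ _ hsq
  rw [CFC.sqrt_mul_self M, CFC.sqrt_mul_self _ hCN0, ContinuousLinearMap.le_def] at hle
  have := hle.re_inner_nonneg_left x
  rw [_root_.sub_apply, inner_sub_left, _root_.smul_apply,
    inner_smul_left] at this
  simpa using this

theorem isSelfAdjoint_abs (a : E →L[ℂ] E) : (CFC.abs a)† = CFC.abs a :=
  (IsSelfAdjoint.of_nonneg (CFC.abs_nonneg a)).star_eq

theorem isPositive_abs (a : E →L[ℂ] E) : (CFC.abs a).IsPositive :=
  (ContinuousLinearMap.nonneg_iff_isPositive _).1 (CFC.abs_nonneg a)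

theorem norm_abs_apply (a : E →L[ℂ] E) (x : E) : ‖CFC.abs a x‖ = ‖a x‖ := by
  have hAA : CFC.abs a ∘L CFC.abs a = a† ∘L a := CFC.abs_mul_abs a
  have h1 : inner ℂ (CFC.abs a x) (CFC.abs a x) = inner ℂ (a x) (a x) := by
    rw [← ContinuousLinearMap.adjoint_inner_right, ← ContinuousLinearMap.adjoint_inner_right,
      isSelfAdjoint_abs]
    exact congrArg (fun S : E →L[ℂ] E => inner ℂ x (S x)) hAA
  rw [@norm_eq_sqrt_re_inner ℂ, @norm_eq_sqrt_re_inner ℂ, h1]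

theorem adjoint_sqrtAbs (a : E →L[ℂ] E) : (sqrtAbs a)† = sqrtAbs a :=
  (IsSelfAdjoint.of_nonneg (CFC.sqrt_nonneg (CFC.abs a))).star_eq

theorem sqrtAbs_sqrtAbs (a : E →L[ℂ] E) (x : E) : sqrtAbs a (sqrtAbs a x) = CFC.abs a x :=
  congrArg (fun S : E →L[ℂ] E => S x) (CFC.sqrt_mul_sqrt_self (CFC.abs a) (CFC.abs_nonneg a))

theorem inner_sqrtAbs_left (a : E →L[ℂ] E) (x y : E) :
    inner ℂ (sqrtAbs a x) y = inner ℂ x (sqrtAbs a y) := by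
  rw [← ContinuousLinearMap.adjoint_inner_right, adjoint_sqrtAbs]

theorem norm_sqrtAbs_sq (a : E →L[ℂ] E) (x : E) :
    ‖sqrtAbs a x‖ ^ 2 = (inner ℂ (CFC.abs a x) x).re := by
  rw [← sqrtAbs_sqrtAbs, inner_sqrtAbs_left]
  exact InnerProductSpace.norm_sq_eq_re_inner (𝕜 := ℂ) _

theorem sqrtAbs_eq_zero_iff (a : E →L[ℂ] E) (x : E) : sqrtAbs a x = 0 ↔ a x = 0 := by
  constructor
  · intro h
    rw [← norm_eq_zero, ← norm_abs_apply, ← sqrtAbs_sqrtAbs, h, map_zero, norm_zero]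
  · intro h
    have : CFC.abs a x = 0 := by rw [← norm_eq_zero, norm_abs_apply, h, norm_zero]
    rw [← norm_eq_zero, ← sq_eq_zero_iff, norm_sqrtAbs_sq, this]
    simp

theorem ker_sqrtAbs (a : E →L[ℂ] E) : (sqrtAbs a).ker = a.ker := by
  ext x
  exact sqrtAbs_eq_zero_iff a x

theorem ker_abs (a : E →L[ℂ] E) : (CFC.abs a).ker = a.ker := by
  ext x
  change CFC.abs a x = 0 ↔ a x = 0
  rw [← norm_eq_zero, norm_abs_apply, norm_eq_zero]

theorem orthogonal_ker_eq_closure_range_sqrtAbs (a : E →L[ℂ] E) :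
    a.kerᗮ = (sqrtAbs a).range.topologicalClosure := by
  rw [← ker_sqrtAbs, ContinuousLinearMap.orthogonal_ker, adjoint_sqrtAbs]

theorem orthogonal_ker_eq_closure_range_abs (a : E →L[ℂ] E) :
    a.kerᗮ = (CFC.abs a).range.topologicalClosure := by
  rw [← ker_abs, ContinuousLinearMap.orthogonal_ker, isSelfAdjoint_abs]

/-- A bounded operator vanishing on `R(|a|)` vanishes on `N(a)ᗮ`. -/
theorem apply_eq_zero_of_abs (a T : E →L[ℂ] E) (h : ∀ x, T (CFC.abs a x) = 0) {x : E}
    (hx : x ∈ a.kerᗮ) : T x = 0 := by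
  rw [orthogonal_ker_eq_closure_range_abs] at hx
  have : (CFC.abs a).range.topologicalClosure ≤ T.ker :=
    Submodule.topologicalClosure_minimal _ (by rintro _ ⟨y, rfl⟩; exact h y) T.isClosed_ker
  exact this hx

/-- A bounded operator vanishing on `R(|a|)` and on `N(a)` is zero. -/
theorem eq_zero_of_abs_of_ker (a T : E →L[ℂ] E) (h : ∀ x, T (CFC.abs a x) = 0)
    (h' : ∀ x, a x = 0 → T x = 0) (x : E) : T x = 0 := by
  have hc : CompleteSpace a.ker := a.isClosed_ker.completeSpace_coe
  have h1 := apply_eq_zero_of_abs a T h (Submodule.sub_starProjection_mem_orthogonal (K := a.ker) x)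
  have h2 := h' _ (Submodule.starProjection_apply_mem a.ker x)
  rwa [map_sub, h2, sub_zero] at h1

theorem isPolarFactor_polarFactor (a : E →L[ℂ] E) : IsPolarFactor a (polarFactor a) :=
  (existsUnique_polarFactor a).choose_spec.1

theorem polarFactor_abs (a : E →L[ℂ] E) (x : E) : polarFactor a (CFC.abs a x) = a x :=
  (congrArg (fun S : E →L[ℂ] E => S x) (isPolarFactor_polarFactor a).eq).symm

theorem polarFactor_of_apply_eq_zero (a : E →L[ℂ] E) {x : E} (h : a x = 0) :
    polarFactor a x = 0 := by
  have : x ∈ (polarFactor a).ker := by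
    rw [(isPolarFactor_polarFactor a).ker_eq]
    exact h
  exact this

theorem sqrtAbs_comm (a : E →L[ℂ] E) (ha : IsSelfAdjoint a) (x : E) :
    a (sqrtAbs a x) = sqrtAbs a (a x) := by
  have h1 : Commute (CFC.abs a) a := CFC.commute_abs_self a ha.isStarNormal
  have h2 : Commute (sqrtAbs a) a := by
    unfold sqrtAbs CFC.sqrt
    exact h1.cfcₙ_nnreal _
  exact (congrArg (fun S : E →L[ℂ] E => S x) h2.eq).symm

/-- It suffices to compare the two products on `R(|a|)` and on `N(a)`. On the former, `u|a| = a`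
reduces the claim to the commutation of `a` with `|a|^{1/2}`; on the latter both vanish. -/
theorem polarFactor_sqrtAbs_comm (a : E →L[ℂ] E) (ha : IsSelfAdjoint a) (x : E) :
    polarFactor a (sqrtAbs a x) = sqrtAbs a (polarFactor a x) := by
  refine sub_eq_zero.1 (eq_zero_of_abs_of_ker a
    (polarFactor a ∘L sqrtAbs a - sqrtAbs a ∘L polarFactor a) (fun y => ?_) (fun y hy => ?_) x)
  · change polarFactor a (sqrtAbs a (CFC.abs a y)) - sqrtAbs a (polarFactor a (CFC.abs a y)) = 0
    rw [polarFactor_abs, ← sqrtAbs_comm a ha, ← sqrtAbs_sqrtAbs, sqrtAbs_sqrtAbs a (sqrtAbs a y),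
      polarFactor_abs, sub_self]
  · change polarFactor a (sqrtAbs a y) - sqrtAbs a (polarFactor a y) = 0
    rw [polarFactor_of_apply_eq_zero a hy, (sqrtAbs_eq_zero_iff a y).2 hy]
    simp

theorem sqrtAbs_polarFactor_sqrtAbs (a : E →L[ℂ] E) (ha : IsSelfAdjoint a) (x : E) :
    sqrtAbs a (polarFactor a (sqrtAbs a x)) = a x := by
  rw [← polarFactor_sqrtAbs_comm a ha, sqrtAbs_sqrtAbs, polarFactor_abs]

theorem polarFactor_mem (a : E →L[ℂ] E) (ha : IsSelfAdjoint a) {x : E} (hx : x ∈ a.kerᗮ) :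
    polarFactor a x ∈ a.kerᗮ := by
  rw [orthogonal_ker_eq_closure_range_sqrtAbs] at hx ⊢
  refine map_mem_closure (polarFactor a).continuous hx ?_
  rintro _ ⟨y, rfl⟩
  exact ⟨polarFactor a y, (polarFactor_sqrtAbs_comm a ha y).symm⟩

/-- For selfadjoint `a` the factor `u` is a symmetry on `N(a)ᗮ`, because `a² = |a|²`. This is what
lets `u` be inverted when approximate saddle points are built. -/
theorem polarFactor_polarFactor (a : E →L[ℂ] E) (ha : IsSelfAdjoint a) {x : E}
    (hx : x ∈ a.kerᗮ) : polarFactor a (polarFactor a x) = x := by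
  refine sub_eq_zero.1 (apply_eq_zero_of_abs a (polarFactor a ∘L polarFactor a -
    ContinuousLinearMap.id ℂ E) (fun y => ?_) hx)
  -- A second reduction to `R(|a|)`: on vectors `|a||a|z` both factors `u` can be evaluated, since
  -- `|a|` commutes with `a`.
  refine eq_zero_of_abs_of_ker a ((polarFactor a ∘L polarFactor a -
    ContinuousLinearMap.id ℂ E) ∘L CFC.abs a) (fun z => ?_) (fun z hz => ?_) y
  · change polarFactor a (polarFactor a (CFC.abs a (CFC.abs a z))) - CFC.abs a (CFC.abs a z) = 0
    have h1 : CFC.abs a (a z) = a (CFC.abs a z) :=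
      congrArg (fun S : E →L[ℂ] E => S z) (CFC.commute_abs_self a ha.isStarNormal).eq
    have h2 : CFC.abs a (CFC.abs a z) = a (a z) := by
      have : CFC.abs a * CFC.abs a = a * a := by rw [CFC.abs_mul_abs, ha.star_eq]
      exact congrArg (fun S : E →L[ℂ] E => S z) this
    rw [polarFactor_abs, ← h1, polarFactor_abs, h2, sub_self]
  · have : CFC.abs a z = 0 := by rw [← norm_eq_zero, norm_abs_apply, hz, norm_zero]
    rw [ContinuousLinearMap.comp_apply, this, map_zero]

end Hilbert

/-! ### Weak complementability and the Schur complement in terms of the quadratic form. -/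

section HilbertSchur

open Filter Topology

variable {E : Type*} [NormedAddCommGroup E] [InnerProductSpace ℂ E]

section Blocks

variable {B : E →L[ℂ] E} {S : Submodule ℂ E} [CompleteSpace S]

theorem inner_block11_left (x s : S) : inner ℂ (block11 B S x) s = inner ℂ (B x) (s : E) :=
  Submodule.inner_orthogonalProjectionOnto_eq_of_mem_right s (B x)

theorem inner_block12_left (x : Sᗮ) (s : S) :
    inner ℂ (block12 B S x) s = inner ℂ (B x) (s : E) :=
  Submodule.inner_orthogonalProjectionOnto_eq_of_mem_right s (B x)

theorem inner_block22_left (x y : Sᗮ) : inner ℂ (block22 B S x) y = inner ℂ (B x) (y : E) :=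
  Submodule.inner_orthogonalProjectionOnto_eq_of_mem_right y (B x)

theorem add_orthogonalProjectionOnto (x : E) :
    ((S.orthogonalProjectionOnto x : S) : E) + (Sᗮ.orthogonalProjectionOnto x : Sᗮ) = x :=
  S.starProjection_add_starProjection_orthogonal x

theorem norm_orthogonalProjectionOnto_le (S : Submodule ℂ E) [S.HasOrthogonalProjection]
    (x : E) :
    ‖S.orthogonalProjectionOnto x‖ ≤ ‖x‖ := by
  simpa using (S.orthogonalProjectionOnto).le_of_opNorm_le
    (S.orthogonalProjectionOnto_norm_le) x

end Blocks

variable [CompleteSpace E]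

theorem isSelfAdjoint_block11 {B : E →L[ℂ] E} {S : Submodule ℂ E} [CompleteSpace S]
    (hB : IsSelfAdjoint B) : IsSelfAdjoint (block11 B S) := by
  rw [ContinuousLinearMap.isSelfAdjoint_iff_isSymmetric] at hB ⊢
  intro x y
  change inner ℂ (block11 B S x) y = inner ℂ x (block11 B S y)
  rw [inner_block11_left, ← inner_conj_symm x, inner_block11_left, inner_conj_symm]
  exact hB x y

/-- If the form of `a` is nonnegative on `p`, nonpositive on `q`, and `p`, `q` are `a`-orthogonal
closed complementary subspaces, then the form of `|a|` is equivalent to the form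
`⟨a x, x⟩ - ⟨a y, y⟩`, `x ∈ p`, `y ∈ q`. -/
theorem exists_abs_equiv {a : E →L[ℂ] E} (ha : IsSelfAdjoint a) {p q : Submodule ℂ E}
    (hpq : IsCompl p q) (hp : IsClosed (p : Set E)) (hq : IsClosed (q : Set E))
    (horth : ∀ x ∈ p, ∀ y ∈ q, inner ℂ (a x) y = 0)
    (hpos : ∀ x ∈ p, 0 ≤ (inner ℂ (a x) x).re) (hneg : ∀ y ∈ q, (inner ℂ (a y) y).re ≤ 0) :
    ∃ C : ℝ, 0 ≤ C ∧ ∀ x ∈ p, ∀ y ∈ q,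
      (inner ℂ (a x) x).re - (inner ℂ (a y) y).re ≤ C * ‖sqrtAbs a (x + y)‖ ^ 2 ∧
      ‖sqrtAbs a (x + y)‖ ^ 2 ≤ C * ((inner ℂ (a x) x).re - (inner ℂ (a y) y).re) := by
  have htop : Submodule.IsTopCompl p q := Submodule.IsCompl.isTopCompl_of_isClosed hpq hp hq
  have hsymm : ∀ x y, inner ℂ (a x) y = inner ℂ x (a y) := fun x y => by
    rw [← ContinuousLinearMap.adjoint_inner_right]
    exact congrArg (fun T : E →L[ℂ] E => inner ℂ x (T y)) ha.star_eq
  have horth' : ∀ y ∈ q, ∀ x ∈ p, inner ℂ (a y) x = 0 := fun y hy x hx => by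
    rw [hsymm, ← inner_conj_symm, horth x hx y hy, map_zero]
  -- `σ` is bounded because `p` and `q` are closed, but it is in general not selfadjoint: `p` and
  -- `q` are orthogonal for the form of `a`, not for the inner product. Only `aσ = σ*a` is
  -- available.
  let σ : E →L[ℂ] E := p.projectionL q htop - q.projectionL p htop.symm
  have hσ : ∀ x ∈ p, ∀ y ∈ q, σ (x + y) = x - y := by
    intro x hx y hy
    have e1 : p.projectionL q htop x = x := Submodule.projectionL_apply_left htop ⟨x, hx⟩
    have e2 : p.projectionL q htop y = 0 := Submodule.projectionL_apply_right htop ⟨y, hy⟩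
    have e3 : q.projectionL p htop.symm y = y :=
      Submodule.projectionL_apply_left htop.symm ⟨y, hy⟩
    have e4 : q.projectionL p htop.symm x = 0 :=
      Submodule.projectionL_apply_right htop.symm ⟨x, hx⟩
    change p.projectionL q htop (x + y) - q.projectionL p htop.symm (x + y) = _
    rw [map_add, map_add, e1, e2, e3, e4, add_zero, zero_add]
  have hdec : ∀ z : E, ∃ x ∈ p, ∃ y ∈ q, x + y = z := fun z =>
    Submodule.mem_sup.1 (by rw [hpq.sup_eq_top]; trivial)
  have hσσ : ∀ z, σ (σ z) = z := by
    intro z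
    obtain ⟨x, hx, y, hy, rfl⟩ := hdec z
    rw [hσ x hx y hy, sub_eq_add_neg, hσ x hx (-y) (q.neg_mem hy), sub_neg_eq_add]
  have hcomm : ∀ z, a (σ z) = (σ†) (a z) := by
    intro z
    refine ext_inner_right ℂ fun z' => ?_
    rw [ContinuousLinearMap.adjoint_inner_left]
    obtain ⟨x, hx, y, hy, rfl⟩ := hdec z
    obtain ⟨x', hx', y', hy', rfl⟩ := hdec z'
    rw [hσ x hx y hy, hσ x' hx' y' hy']
    simp only [map_add, map_sub, inner_add_left, inner_add_right, inner_sub_left,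
      inner_sub_right, horth x hx y' hy', horth' y hy x' hx']
    ring
  have hform : ∀ x ∈ p, ∀ y ∈ q, inner ℂ ((a ∘L σ) (x + y)) (x + y) =
      inner ℂ (a x) x - inner ℂ (a y) y := by
    intro x hx y hy
    rw [ContinuousLinearMap.comp_apply, hσ x hx y hy]
    simp only [map_sub, inner_add_right, inner_sub_left, horth x hx y hy, horth' y hy x hx]
    ring
  have hreal : ∀ x, inner ℂ (a x) x = ((inner ℂ (a x) x).re : ℂ) := by
    intro x
    refine (Complex.conj_eq_iff_re.1 ?_).symm
    rw [inner_conj_symm, hsymm]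
  have hM : (a ∘L σ).IsPositive := by
    rw [ContinuousLinearMap.isPositive_iff_complex]
    intro z
    obtain ⟨x, hx, y, hy, rfl⟩ := hdec z
    rw [hform x hx y hy, hreal x, hreal y, ← Complex.ofReal_sub, RCLike.re_to_complex,
      Complex.ofReal_re]
    exact ⟨rfl, by linarith [hpos x hx, hneg y hy]⟩
  have hb : ∀ z, ‖(a ∘L σ) z‖ ≤ ‖σ†‖ * ‖CFC.abs a z‖ := by
    intro z
    rw [norm_abs_apply, ContinuousLinearMap.comp_apply, hcomm]
    exact (σ†).le_opNorm _
  have hb' : ∀ z, ‖CFC.abs a z‖ ≤ ‖σ†‖ * ‖(a ∘L σ) z‖ := by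
    intro z
    -- `σ² = 1` makes the estimate reversible with the same constant.
    have : a z = (σ†) (a (σ z)) := by rw [← hcomm, hσσ]
    rw [norm_abs_apply, this]
    exact (σ†).le_opNorm _
  refine ⟨‖σ†‖, norm_nonneg _, fun x hx y hy => ?_⟩
  have e : (inner ℂ (a x) x).re - (inner ℂ (a y) y).re =
      (inner ℂ ((a ∘L σ) (x + y)) (x + y)).re := by
    rw [hform x hx y hy, Complex.sub_re]
  rw [e, norm_sqrtAbs_sq]
  exact ⟨re_inner_le_of_norm_le hM (isPositive_abs a) (norm_nonneg _) hb _,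
    re_inner_le_of_norm_le (isPositive_abs a) hM (norm_nonneg _) hb' _⟩

/-- The equivalence of `exists_abs_equiv`, for the compression of `B` to `S = p ∔ q`. -/
theorem exists_abs_block11_equiv {B : E →L[ℂ] E} (hB : IsSelfAdjoint B)
    {S p q : Submodule ℂ E} [CompleteSpace S] (hsup : p ⊔ q = S) (hdisj : Disjoint p q)
    (hp : IsClosed (p : Set E)) (hq : IsClosed (q : Set E))
    (horth : ∀ x ∈ p, ∀ y ∈ q, inner ℂ (B x) y = 0)
    (hpos : ∀ x ∈ p, 0 ≤ (inner ℂ (B x) x).re) (hneg : ∀ y ∈ q, (inner ℂ (B y) y).re ≤ 0) :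
    ∃ C : ℝ, 0 ≤ C ∧ ∀ x ∈ p, ∀ y ∈ q, ∀ s : S, (s : E) = x + y →
      (inner ℂ (B x) x).re - (inner ℂ (B y) y).re ≤ C * ‖sqrtAbs (block11 B S) s‖ ^ 2 ∧
      ‖sqrtAbs (block11 B S) s‖ ^ 2 ≤ C * ((inner ℂ (B x) x).re - (inner ℂ (B y) y).re) := by
  have hpS : p ≤ S := hsup ▸ le_sup_left
  have hqS : q ≤ S := hsup ▸ le_sup_right
  have hcompl : IsCompl (p.comap S.subtype) (q.comap S.subtype) := by
    constructor
    · rw [Submodule.disjoint_def]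
      intro x hx hy
      exact Subtype.ext (Submodule.disjoint_def.1 hdisj x hx hy)
    · rw [Submodule.codisjoint_iff_exists_add_eq]
      intro z
      obtain ⟨x, hx, y, hy, hxy⟩ := Submodule.mem_sup.1 (hsup.symm ▸ z.2 : (z : E) ∈ p ⊔ q)
      exact ⟨⟨x, hpS hx⟩, ⟨y, hqS hy⟩, hx, hy, Subtype.ext hxy⟩
  obtain ⟨C, hC0, hC⟩ := exists_abs_equiv (isSelfAdjoint_block11 (S := S) hB) hcompl
    (hp.preimage continuous_subtype_val) (hq.preimage continuous_subtype_val)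
    (fun x hx y hy => by rw [inner_block11_left]; exact horth x hx y hy)
    (fun x hx => by rw [inner_block11_left]; exact hpos x hx)
    (fun x hx => by rw [inner_block11_left]; exact hneg x hx)
  refine ⟨C, hC0, fun x hx y hy s hs => ?_⟩
  have := hC ⟨x, hpS hx⟩ hx ⟨y, hqS hy⟩ hy
  rw [inner_block11_left, inner_block11_left] at this
  have e : s = ⟨x, hpS hx⟩ + ⟨y, hqS hy⟩ := Subtype.ext hs
  rw [e]
  exact this

variable {B : E →L[ℂ] E} {S : Submodule ℂ E} [CompleteSpace S]

/-- Weak complementability, in terms of the form of `B`. -/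
theorem isWeaklyCompl_iff (hB : IsSelfAdjoint B) : IsWeaklyCompl B S ↔
    ∃ C : ℝ, ∀ (x : E) (s : S),
      ‖inner ℂ (B x) (s : E)‖ ≤ C * ‖x‖ * ‖sqrtAbs (block11 B S) s‖ := by
  set r := sqrtAbs (block11 B S) with hr
  set u := polarFactor (block11 B S) with hu
  constructor
  · intro h
    obtain ⟨f, hf, -⟩ := existsUnique_reducedSolution _ _ h
    -- The component of `x` in `S` contributes `‖u‖‖r‖` through `a = r u r`, the component in `Sᗮ`
    -- contributes `‖f‖` through `b = r f`.
    refine ⟨‖u‖ * ‖r‖ + ‖f‖, fun x s => ?_⟩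
    have e1 : inner ℂ (B (S.orthogonalProjectionOnto x)) (s : E) =
        inner ℂ (u (r (S.orthogonalProjectionOnto x))) (r s) := by
      rw [← inner_block11_left, ← inner_sqrtAbs_left, hu, hr, sqrtAbs_polarFactor_sqrtAbs _
        (isSelfAdjoint_block11 hB)]
    have e2 : inner ℂ (B (Sᗮ.orthogonalProjectionOnto x)) (s : E) =
        inner ℂ (f (Sᗮ.orthogonalProjectionOnto x)) (r s) := by
      rw [← inner_block12_left, hf.eq, ← inner_sqrtAbs_left]
      rfl
    conv_lhs => rw [← add_orthogonalProjectionOnto (S := S) x, map_add, inner_add_left, e1, e2,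
      ← inner_add_left]
    refine (norm_inner_le_norm _ _).trans ?_
    gcongr
    refine (norm_add_le _ _).trans ?_
    rw [add_mul]
    gcongr
    · rw [mul_assoc]
      refine u.le_opNorm_of_le (r.le_opNorm_of_le ?_)
      exact norm_orthogonalProjectionOnto_le S x
    · exact f.le_opNorm_of_le (norm_orthogonalProjectionOnto_le Sᗮ x)
  · rintro ⟨C, hC⟩
    refine range_le_of_norm_adjoint_le _ _ |C| fun s => ?_
    rw [adjoint_sqrtAbs]
    set v := ((block12 B S)†) s with hv
    by_cases h0 : ‖v‖ = 0
    · rw [h0]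
      positivity
    -- Testing the bound on `x = b*s` gives `‖b*s‖² ≤ |C| ‖b*s‖ ‖r s‖`, the estimate needed for
    -- Douglas' criterion.
    have h1 : inner ℂ v v = inner ℂ (B v) (s : E) := by
      conv_lhs => rw [hv, ContinuousLinearMap.adjoint_inner_right]
      rw [inner_block12_left]
    have h2 : ‖v‖ * ‖v‖ ≤ |C| * ‖r s‖ * ‖v‖ := by
      rw [← inner_self_eq_norm_mul_norm (𝕜 := ℂ)]
      refine (Complex.re_le_norm _).trans ?_
      rw [h1]
      refine (hC v s).trans ?_
      rw [mul_right_comm]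
      gcongr
      · exact le_abs_self C
      · exact le_rfl
    exact le_of_mul_le_mul_right h2 (lt_of_le_of_ne (norm_nonneg v) (Ne.symm h0))

/-- The Schur complement is the limit of the form of `B` along approximate minimax points. -/
theorem exists_tendsto_schurCompl (hB : IsSelfAdjoint B) (h : IsWeaklyCompl B S) (x : E) :
    ∃ (s : ℕ → S) (ε : ℕ → ℝ) (C : ℝ), Tendsto ε atTop (𝓝 0) ∧ (∀ n, 0 ≤ ε n) ∧
      (∀ n (t : S), ‖inner ℂ (B (x - s n)) (t : E)‖ ≤ ε n * ‖sqrtAbs (block11 B S) t‖) ∧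
      (∀ n, ‖sqrtAbs (block11 B S) (s n)‖ ≤ C) ∧
      ∀ y, Tendsto (fun n => inner ℂ (B (x - s n)) y) atTop
        (𝓝 (inner ℂ (schurCompl B S h x) y)) := by
  have ha : IsSelfAdjoint (block11 B S) := isSelfAdjoint_block11 hB
  have hf : IsReducedSolution (block12 B S) (sqrtAbs (block11 B S))
      (reducedSolution (block12 B S) (sqrtAbs (block11 B S)) h) :=
    (existsUnique_reducedSolution _ _ h).choose_spec.1
  have hschur : ∀ y, inner ℂ (schurCompl B S h x) y =
      inner ℂ (B (Sᗮ.orthogonalProjectionOnto x)) (Sᗮ.orthogonalProjectionOnto y : E) -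
      inner ℂ (polarFactor (block11 B S) (reducedSolution (block12 B S) (sqrtAbs (block11 B S)) h
        (Sᗮ.orthogonalProjectionOnto x))) (reducedSolution (block12 B S) (sqrtAbs (block11 B S)) h
        (Sᗮ.orthogonalProjectionOnto y)) := by
    intro y
    rw [← inner_block22_left, ← ContinuousLinearMap.adjoint_inner_left
      (reducedSolution (block12 B S) (sqrtAbs (block11 B S)) h), ← inner_sub_left]
    exact (Submodule.inner_orthogonalProjectionOnto_eq_of_mem_left _ y).symm
  set r := sqrtAbs (block11 B S) with hr
  set u := polarFactor (block11 B S) with hu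
  set f := reducedSolution (block12 B S) r h with hfdef
  set x₁ := S.orthogonalProjectionOnto x with hx₁
  set x₂ := Sᗮ.orthogonalProjectionOnto x with hx₂
  have hfx : f x₂ ∈ (block11 B S).kerᗮ := by
    rw [orthogonal_ker_eq_closure_range_sqrtAbs]
    have := hf.range_le ⟨x₂, rfl⟩
    rwa [adjoint_sqrtAbs] at this
  have hufx : u (f x₂) ∈ (block11 B S).kerᗮ := polarFactor_mem _ ha hfx
  rw [orthogonal_ker_eq_closure_range_sqrtAbs] at hufx
  -- An exact saddle point `x₁ + t` would need `r t = u f x₂`. The right side is only known to lie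
  -- in the closure of `R(r)`, so it is approximated by `v n = r (t n)`; the residual `f x₂ - u (v
  -- n)` tends to `f x₂ - u u f x₂ = 0`.
  obtain ⟨v, hv, hlim⟩ := mem_closure_iff_seq_limit.1 hufx
  choose t ht using hv
  replace ht : ∀ n, r (t n) = v n := ht
  have hb : ∀ (z : Sᗮ) (s : S), inner ℂ (B z) (s : E) = inner ℂ (f z) (r s) := by
    intro z s
    rw [← inner_block12_left, hf.eq, ← inner_sqrtAbs_left]
    rfl
  have ha' : ∀ z s : S, inner ℂ (B z) (s : E) = inner ℂ (u (r z)) (r s) := by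
    intro z s
    rw [← inner_block11_left, ← inner_sqrtAbs_left, hu, hr, sqrtAbs_polarFactor_sqrtAbs _ ha]
  have hsub : ∀ n, x - ((x₁ + t n : S) : E) = x₂ - t n := by
    intro n
    conv_lhs => rw [← add_orthogonalProjectionOnto (S := S) x]
    push_cast
    abel
  have hS : ∀ n (s : S), inner ℂ (B (x - ((x₁ + t n : S) : E))) (s : E) =
      inner ℂ (f x₂ - u (v n)) (r s) := by
    intro n s
    rw [hsub, map_sub, inner_sub_left, hb, ha', ht, ← inner_sub_left]
  have hε : Tendsto (fun n => ‖f x₂ - u (v n)‖) atTop (𝓝 0) := by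
    have h1 : Tendsto (fun n => u (v n)) atTop (𝓝 (u (u (f x₂)))) :=
      (u.continuous.tendsto _).comp hlim
    rw [polarFactor_polarFactor _ ha hfx] at h1
    simpa using ((tendsto_const_nhds (x := f x₂)).sub h1).norm
  have hC : ∃ C, ∀ n, ‖v n‖ ≤ C := by
    obtain ⟨C, hC⟩ := hlim.norm.bddAbove_range
    exact ⟨C, fun n => hC ⟨n, rfl⟩⟩
  obtain ⟨C, hC⟩ := hC
  refine ⟨fun n => x₁ + t n, fun n => ‖f x₂ - u (v n)‖, ‖r x₁‖ + C, hε,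
    fun n => norm_nonneg _, fun n s => ?_, fun n => ?_, fun y => ?_⟩
  · rw [hS]
    exact norm_inner_le_norm _ _
  · rw [map_add, ht]
    exact (norm_add_le _ _).trans (by gcongr; exact hC n)
  · rw [hschur]
    -- The test vector `y` is split: its part in `S` sees only the residual, its part in `Sᗮ` gives
    -- `⟨c x₂, y₂⟩ - ⟨v n, f y₂⟩`, whose limit is the form of `c - f*uf`.
    have h1 : Tendsto (fun n => inner ℂ (f x₂ - u (v n)) (r (S.orthogonalProjectionOnto y)))
        atTop (𝓝 0) := by
      have : Tendsto (fun n => f x₂ - u (v n)) atTop (𝓝 0) :=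
        tendsto_zero_iff_norm_tendsto_zero.2 hε
      have h0 := this.inner (𝕜 := ℂ) (tendsto_const_nhds (x := r (S.orthogonalProjectionOnto y)))
      rwa [inner_zero_left] at h0
    have h2 : Tendsto (fun n => inner ℂ (B x₂) (Sᗮ.orthogonalProjectionOnto y : E) -
        inner ℂ (v n) (f (Sᗮ.orthogonalProjectionOnto y))) atTop
        (𝓝 (inner ℂ (B x₂) (Sᗮ.orthogonalProjectionOnto y : E) -
          inner ℂ (u (f x₂)) (f (Sᗮ.orthogonalProjectionOnto y)))) :=
      tendsto_const_nhds.sub (hlim.inner tendsto_const_nhds)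
    have h3 := h1.add h2
    rw [zero_add] at h3
    refine h3.congr fun n => ?_
    rw [← hS]
    have e1 : inner ℂ (v n) (f (Sᗮ.orthogonalProjectionOnto y)) =
        inner ℂ (B (t n)) (Sᗮ.orthogonalProjectionOnto y : E) := by
      have hsym : inner ℂ (B (t n)) (Sᗮ.orthogonalProjectionOnto y : E) =
          inner ℂ (t n : E) (B (Sᗮ.orthogonalProjectionOnto y)) :=
        (ContinuousLinearMap.isSelfAdjoint_iff_isSymmetric.1 hB) _ _
      rw [hsym, ← inner_conj_symm (t n : E), hb, inner_conj_symm, ht]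
    rw [e1, ← inner_sub_left, ← map_sub, ← hsub, ← inner_add_right, add_orthogonalProjectionOnto]

end HilbertSchur

/-! ### The symmetry `W ↦ -W` in the Krein space. -/

namespace KreinSpace

open Filter Topology

variable {V : Type*} [AddCommGroup V] [Module ℂ V] {K : KreinSpace V}

theorem IsBounded.sub {X Y : V →ₗ[ℂ] V} (hX : K.IsBounded X) (hY : K.IsBounded Y) :
    K.IsBounded (X - Y) := by
  obtain ⟨D, hD⟩ := hX
  exact ⟨D, hD.sub (hY.continuous D)⟩

theorem IsBounded.neg {X : V →ₗ[ℂ] V} (hX : K.IsBounded X) : K.IsBounded (-X) := by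
  obtain ⟨D, hD⟩ := hX
  exact ⟨D, hD.neg⟩

theorem IsBoundedSelfAdjoint.sub {X Y : V →ₗ[ℂ] V} (hX : K.IsBoundedSelfAdjoint X)
    (hY : K.IsBoundedSelfAdjoint Y) : K.IsBoundedSelfAdjoint (X - Y) where
  bounded := hX.bounded.sub hY.bounded
  selfAdjoint x y := by
    simp only [LinearMap.sub_apply, map_sub, hX.selfAdjoint, hY.selfAdjoint]

theorem IsBoundedSelfAdjoint.neg {X : V →ₗ[ℂ] V} (hX : K.IsBoundedSelfAdjoint X) :
    K.IsBoundedSelfAdjoint (-X) where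
  bounded := hX.bounded.neg
  selfAdjoint x y := by
    simp only [LinearMap.neg_apply, map_neg, hX.selfAdjoint]

theorem IsBoundedSelfAdjoint.conj_form {X : V →ₗ[ℂ] V} (hX : K.IsBoundedSelfAdjoint X) (x y : V) :
    conj (K.form (X x) y) = K.form (X y) x := by
  rw [K.hermitian, hX.selfAdjoint]

theorem opLE_neg_neg {X Y : V →ₗ[ℂ] V} (h : K.OpLE X Y) : K.OpLE (-Y) (-X) := by
  have e : -X - -Y = Y - X := by abel
  exact ⟨e ▸ h.isBoundedSelfAdjoint, e ▸ h.nonneg⟩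

theorem range_neg_le {X : V →ₗ[ℂ] V} {M : Submodule ℂ V} (h : LinearMap.range X ≤ M) :
    LinearMap.range (-X) ≤ M := by
  rintro _ ⟨x, rfl⟩
  exact M.neg_mem (h ⟨x, rfl⟩)

theorem neg_mem_upperSet {X W : V →ₗ[ℂ] V} {M : Submodule ℂ V} (h : X ∈ K.lowerSet W M) :
    -X ∈ K.upperSet (-W) M :=
  ⟨h.1.neg, opLE_neg_neg h.2.1, range_neg_le h.2.2⟩

theorem neg_mem_lowerSet {X W : V →ₗ[ℂ] V} {M : Submodule ℂ V} (h : X ∈ K.upperSet W M) :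
    -X ∈ K.lowerSet (-W) M :=
  ⟨h.1.neg, opLE_neg_neg h.2.1, range_neg_le h.2.2⟩

theorem IsMaximum.neg {X W : V →ₗ[ℂ] V} {M : Submodule ℂ V}
    (h : K.IsMaximum (K.lowerSet W M) X) : K.IsMinimum (K.upperSet (-W) M) (-X) := by
  refine ⟨neg_mem_upperSet h.1, fun Y hY => ?_⟩
  have := opLE_neg_neg (h.2 (-Y) (by simpa using neg_mem_lowerSet hY))
  rwa [neg_neg] at this

theorem IsMinimum.neg {X W : V →ₗ[ℂ] V} {M : Submodule ℂ V}
    (h : K.IsMinimum (K.upperSet W M) X) : K.IsMaximum (K.lowerSet (-W) M) (-X) := by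
  refine ⟨neg_mem_lowerSet h.1, fun Y hY => ?_⟩
  have := opLE_neg_neg (h.2 (-Y) (by simpa using neg_mem_upperSet hY))
  rwa [neg_neg] at this

theorem IsMinMax.neg {W T : V →ₗ[ℂ] V} {Sp Sm : Submodule ℂ V} (h : K.IsMinMax W Sp Sm T) :
    K.IsMaxMin (-W) Sm Sp (-T) := by
  obtain ⟨M, hM, hT⟩ := h
  exact ⟨-M, hM.neg, hT.neg⟩

theorem IsSignDecomposition.neg {D : K.Decomposition} {W : V →ₗ[ℂ] V} {S Sp Sm : Submodule ℂ V}
    (hW : K.IsBoundedSelfAdjoint W) (h : K.IsSignDecomposition D W S Sp Sm) :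
    K.IsSignDecomposition D (-W) S Sm Sp where
  sup_eq := by rw [sup_comm, h.sup_eq]
  disjoint := h.disjoint.symm
  closed_pos := h.closed_neg
  closed_neg := h.closed_pos
  form_eq_zero s hs t ht := by
    rw [LinearMap.neg_apply, map_neg, LinearMap.neg_apply, ← hW.conj_form, h.form_eq_zero t ht s hs,
      map_zero, neg_zero]
  nonneg s hs := by simpa using h.nonpos s hs
  nonpos s hs := by simpa using h.nonneg s hs
  orthogonal := h.orthogonal.symm

/-- Lets every result about `S` be applied to `S₊` alone, which produces the inner extremum. -/
theorem IsSignDecomposition.pos_bot {D : K.Decomposition} {W : V →ₗ[ℂ] V}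
    {S Sp Sm : Submodule ℂ V} (h : K.IsSignDecomposition D W S Sp Sm) :
    K.IsSignDecomposition D W Sp Sp ⊥ where
  sup_eq := sup_bot_eq _
  disjoint := disjoint_bot_right
  closed_pos := h.closed_pos
  closed_neg := ⟨D, by
    have : D.sub ⊥ = ⊥ := Submodule.map_bot _
    rw [this]
    exact isClosed_singleton⟩
  form_eq_zero s _ t ht := by rw [(Submodule.mem_bot ℂ).1 ht, map_zero]
  nonneg := h.nonneg
  nonpos s hs := by rw [(Submodule.mem_bot ℂ).1 hs]; simp
  orthogonal := by
    have : D.sub ⊥ = ⊥ := Submodule.map_bot _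
    rw [this]
    exact Submodule.isOrtho_bot_right

/-! ### Schur limits and their extremal properties. -/

/-- `T` is the limit of the form of `W` along approximate minimax points, where `W` is nonnegative
on `Sp` and nonpositive on `Sm`. -/
def IsSchurLimit (K : KreinSpace V) (W : V →ₗ[ℂ] V) (Sp Sm : Submodule ℂ V) (T : V →ₗ[ℂ] V) :
    Prop :=
  ∀ x, ∃ (s t : ℕ → V) (ε : ℕ → ℝ) (C : ℝ), Tendsto ε atTop (𝓝 0) ∧ (∀ n, 0 ≤ ε n) ∧
    (∀ n, s n ∈ Sp) ∧ (∀ n, t n ∈ Sm) ∧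
    (∀ n, ∀ p ∈ Sp, ‖K.form (W (x - s n - t n)) p‖ ^ 2 ≤ ε n * (K.form (W p) p).re) ∧
    (∀ n, ∀ q ∈ Sm, ‖K.form (W (x - s n - t n)) q‖ ^ 2 ≤ ε n * -(K.form (W q) q).re) ∧
    (∀ n, (K.form (W (s n)) (s n)).re ≤ C) ∧ (∀ n, -(K.form (W (t n)) (t n)).re ≤ C) ∧
    ∀ y, Tendsto (fun n => K.form (W (x - s n - t n)) y) atTop (𝓝 (K.form (T x) y))

theorem form_sub_apply (X Y : V →ₗ[ℂ] V) (x y : V) :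
    K.form ((X - Y) x) y = K.form (X x) y - K.form (Y x) y := by
  rw [LinearMap.sub_apply, map_sub, LinearMap.sub_apply]

theorem tendsto_form_sub_sub {w s t : ℕ → V} {y : V} {l : ℂ}
    (h : Tendsto (fun n => K.form (w n) y) atTop (𝓝 l))
    (hs : Tendsto (fun n => K.form (w n) (s n)) atTop (𝓝 0))
    (ht : Tendsto (fun n => K.form (w n) (t n)) atTop (𝓝 0)) :
    Tendsto (fun n => K.form (w n) (y - s n - t n)) atTop (𝓝 l) := by
  have := (h.sub hs).sub ht
  rw [sub_zero, sub_zero] at this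
  refine this.congr fun n => ?_
  rw [map_sub, map_sub]

/-- The residual `W(x - s n - t n)` paired with a sequence of bounded energy `d n` tends to zero,
even if that sequence itself is unbounded in norm. -/
theorem tendsto_zero_of_norm_sq_le {u : ℕ → ℂ} {ε d : ℕ → ℝ} {C : ℝ}
    (hε : Tendsto ε atTop (𝓝 0)) (hε0 : ∀ n, 0 ≤ ε n) (hd : ∀ n, d n ≤ C)
    (h : ∀ n, ‖u n‖ ^ 2 ≤ ε n * d n) : Tendsto u atTop (𝓝 0) := by
  rw [tendsto_zero_iff_norm_tendsto_zero]
  have h1 : Tendsto (fun n => ‖u n‖ ^ 2) atTop (𝓝 0) := by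
    refine squeeze_zero (fun n => by positivity)
      (fun n => (h n).trans (mul_le_mul_of_nonneg_left (hd n) (hε0 n))) ?_
    simpa using hε.mul_const C
  have h2 := h1.sqrt
  simpa [Real.sqrt_sq] using h2

section SchurLimit

variable {W T : V →ₗ[ℂ] V} {Sp Sm : Submodule ℂ V}

theorem IsSchurLimit.neg (h : K.IsSchurLimit W Sp Sm T) : K.IsSchurLimit (-W) Sm Sp (-T) := by
  intro x
  obtain ⟨s, t, ε, C, hε, hε0, hs, ht, hp, hq, hsC, htC, hlim⟩ := h x
  have e : ∀ n, x - t n - s n = x - s n - t n := fun n => sub_right_comm _ _ _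
  refine ⟨t, s, ε, C, hε, hε0, ht, hs, fun n p hp' => ?_, fun n q hq' => ?_, fun n => ?_,
    fun n => ?_, fun y => ?_⟩
  · rw [e, LinearMap.neg_apply, map_neg, LinearMap.neg_apply, norm_neg, LinearMap.neg_apply,
      map_neg, LinearMap.neg_apply, Complex.neg_re]
    exact hq n p hp'
  · rw [e, LinearMap.neg_apply, map_neg, LinearMap.neg_apply, norm_neg, LinearMap.neg_apply,
      map_neg, LinearMap.neg_apply, Complex.neg_re, neg_neg]
    exact hp n q hq'
  · simpa using htC n
  · simpa using hsC n
  · simp only [e, LinearMap.neg_apply, map_neg]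
    exact (hlim y).neg

theorem IsSchurLimit.range_le_companion (h : K.IsSchurLimit W Sp Sm T) :
    LinearMap.range T ≤ K.companion Sp := by
  rintro _ ⟨x, rfl⟩ p hp
  obtain ⟨s, t, ε, C, hε, hε0, hs, ht, hP, hq, hsC, htC, hlim⟩ := h x
  exact tendsto_nhds_unique (hlim p)
    (tendsto_zero_of_norm_sq_le hε hε0 (fun _ => le_rfl) (fun n => hP n p hp))

/-- Correcting the second argument by `s' n + t' n` does not change the limit, so `[Tx, y]` and the
conjugate of `[Ty, x]` are limits of the same sequence `[W(x - s n - t n), y - s' n - t' n]`. -/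
theorem IsSchurLimit.isBoundedSelfAdjoint (hW : K.IsBoundedSelfAdjoint W) (hT : K.IsBounded T)
    (h : K.IsSchurLimit W Sp Sm T) : K.IsBoundedSelfAdjoint T := by
  refine ⟨hT, fun x y => ?_⟩
  obtain ⟨s, t, ε, C, hε, hε0, hs, ht, hp, hq, hsC, htC, hlim⟩ := h x
  obtain ⟨s', t', ε', C', hε', hε0', hs', ht', hp', hq', hsC', htC', hlim'⟩ := h y
  have h1 : Tendsto (fun n => K.form (W (x - s n - t n)) (y - s' n - t' n)) atTop
      (𝓝 (K.form (T x) y)) := by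
    have e1 := tendsto_zero_of_norm_sq_le hε hε0 hsC' (fun n => hp n _ (hs' n))
    have e2 := tendsto_zero_of_norm_sq_le hε hε0 htC' (fun n => hq n _ (ht' n))
    exact tendsto_form_sub_sub (hlim y) e1 e2
  have h2 : Tendsto (fun n => K.form (W (y - s' n - t' n)) (x - s n - t n)) atTop
      (𝓝 (K.form (T y) x)) := by
    have e1 := tendsto_zero_of_norm_sq_le hε' hε0' hsC (fun n => hp' n _ (hs n))
    have e2 := tendsto_zero_of_norm_sq_le hε' hε0' htC (fun n => hq' n _ (ht n))
    exact tendsto_form_sub_sub (hlim' x) e1 e2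
  have h3 := (Complex.continuous_conj.tendsto _).comp h2
  rw [K.hermitian] at h3
  refine tendsto_nhds_unique h1 (h3.congr fun n => ?_)
  exact hW.conj_form _ _

/-- If `W` is nonnegative on `Sp`, the Schur limit is the largest selfadjoint operator below `W`
with range in the orthogonal companion of `Sp`. -/
theorem IsSchurLimit.isMaximum (hW : K.IsBoundedSelfAdjoint W) (hT : K.IsBounded T)
    (hpos : ∀ s ∈ Sp, 0 ≤ (K.form (W s) s).re) (h : K.IsSchurLimit W Sp ⊥ T) :
    K.IsMaximum (K.lowerSet W (K.companion Sp)) T := by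
  have hTsa := h.isBoundedSelfAdjoint hW hT
  refine ⟨⟨hTsa, ⟨hW.sub hTsa, fun x => ?_⟩, h.range_le_companion⟩,
    fun Y hY => ⟨hTsa.sub hY.1, fun x => ?_⟩⟩
  · obtain ⟨s, t, ε, C, hε, hε0, hs, ht, hp, hq, hsC, htC, hlim⟩ := h x
    have ht0 : ∀ n, t n = 0 := fun n => (Submodule.mem_bot ℂ).1 (ht n)
    simp only [ht0, sub_zero] at hp hlim
    have e1 := tendsto_zero_of_norm_sq_le hε hε0 hsC (fun n => hp n _ (hs n))
    -- The terms equal `[W s n, s n] ≥ 0`, so `[(W - T)x, x]` is a limit of nonnegative numbers.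
    have h1 : Tendsto (fun n => (K.form (W x) x - K.form (W (x - s n)) x
        - conj (K.form (W (x - s n)) (s n))).re) atTop (𝓝 (K.form ((W - T) x) x).re) := by
      have := (tendsto_const_nhds (x := K.form (W x) x)).sub (hlim x)
      have h2 := this.sub ((Complex.continuous_conj.tendsto _).comp e1)
      have h3 := (Complex.continuous_re.tendsto _).comp h2
      rw [map_zero, sub_zero, ← form_sub_apply] at h3
      exact h3
    refine ge_of_tendsto' h1 fun n => ?_
    rw [hW.conj_form]
    have : K.form (W x) x - K.form (W (x - s n)) x - K.form (W (s n)) (x - s n) =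
        K.form (W (s n)) (s n) := by
      simp only [map_sub, LinearMap.sub_apply]
      ring
    rw [this]
    exact hpos _ (hs n)
  · obtain ⟨s, t, ε, C, hε, hε0, hs, ht, hp, hq, hsC, htC, hlim⟩ := h x
    have ht0 : ∀ n, t n = 0 := fun n => (Submodule.mem_bot ℂ).1 (ht n)
    simp only [ht0, sub_zero] at hp hlim
    have e1 := tendsto_zero_of_norm_sq_le hε hε0 hsC (fun n => hp n _ (hs n))
    -- A competitor `Y` does not see the shift by `s n`, while `[W(x - s n), x - s n]` decreases to
    -- `[Tx, x]` up to a vanishing error; hence `Y ≤ W` passes to `Y ≤ T`.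
    have h1 : Tendsto (fun n => (K.form ((W - Y) (x - s n)) (x - s n)).re) atTop
        (𝓝 (K.form ((T - Y) x) x).re) := by
      have h2 := ((hlim x).sub e1).sub (tendsto_const_nhds (x := K.form (Y x) x))
      have h3 := (Complex.continuous_re.tendsto _).comp h2
      have e2 : K.form (T x) x - 0 - K.form (Y x) x = K.form ((T - Y) x) x := by simp
      rw [e2] at h3
      refine h3.congr fun n => ?_
      have y1 : ∀ z, K.form (Y z) (s n) = 0 := fun z => hY.2.2 ⟨z, rfl⟩ _ (hs n)
      have y2 : K.form (Y (s n)) x = 0 := by rw [← hY.1.conj_form, y1, map_zero]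
      have e3 : K.form (Y (x - s n)) (x - s n) = K.form (Y x) x := by
        rw [map_sub (K.form _), y1, sub_zero, map_sub, map_sub, LinearMap.sub_apply, y2, sub_zero]
      simp only [Function.comp, LinearMap.sub_apply, map_sub K.form, e3,
        map_sub (K.form (W (x - s n)))]
    exact ge_of_tendsto' h1 fun n => hY.2.1.nonneg _

/-- The Schur limit as an iterated extremum. -/
theorem IsSchurLimit.isMinMax {M : V →ₗ[ℂ] V} (hW : K.IsBoundedSelfAdjoint W)
    (hT : K.IsBounded T) (hM : K.IsBounded M)
    (horth : ∀ s ∈ Sp, ∀ t ∈ Sm, K.form (W s) t = 0)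
    (hpos : ∀ s ∈ Sp, 0 ≤ (K.form (W s) s).re) (hneg : ∀ s ∈ Sm, (K.form (W s) s).re ≤ 0)
    (hlimM : K.IsSchurLimit W Sp ⊥ M) (h : K.IsSchurLimit W Sp Sm T) :
    K.IsMinMax W Sp Sm T := by
  have hTsa := h.isBoundedSelfAdjoint hW hT
  have hMsa := hlimM.isBoundedSelfAdjoint hW hM
  have hMmax := hlimM.isMaximum hW hM hpos
  have hMSp : ∀ x, ∀ s ∈ Sp, K.form (M x) s = 0 := fun x s hs =>
    hlimM.range_le_companion ⟨x, rfl⟩ s hs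
  have hMSp' : ∀ s ∈ Sp, ∀ x, K.form (M s) x = 0 := fun s hs x => by
    rw [← hMsa.conj_form, hMSp x s hs, map_zero]
  -- The corrections `s n` lie in `S₊`, which is `W`-orthogonal to `S₋`, so passing from `W` to `M`
  -- changes nothing against `S₋`.
  have hMSm : ∀ x, ∀ q ∈ Sm, K.form (M x) q = K.form (W x) q := by
    intro x q hq
    obtain ⟨s, t, ε, C, hε, hε0, hs, ht, -, -, hsC, htC, hlim⟩ := hlimM x
    refine tendsto_nhds_unique (hlim q) (tendsto_const_nhds.congr fun n => ?_)
    rw [(Submodule.mem_bot ℂ).1 (ht n), sub_zero, map_sub, map_sub, LinearMap.sub_apply,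
      horth _ (hs n) q hq, sub_zero]
  refine ⟨M, hMmax, ⟨hTsa, ⟨hTsa.sub hMsa, fun x => ?_⟩, ?_⟩,
    fun Y hY => ⟨hY.1.sub hTsa, fun x => ?_⟩⟩
  · obtain ⟨s, t, ε, C, hε, hε0, hs, ht, hp, hq, hsC, htC, hlim⟩ := h x
    have e1 := tendsto_zero_of_norm_sq_le hε hε0 hsC (fun n => hp n _ (hs n))
    have e2 := tendsto_zero_of_norm_sq_le hε hε0 htC (fun n => hq n _ (ht n))
    -- With `z = x - s n - t n`, the terms equal `[(W - M)z, z] - [W t n, t n]`, where both summands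
    -- are nonnegative. The middle term `2 Re [Wz, t n]` is added for this identity and vanishes in
    -- the limit.
    have h1 : Tendsto (fun n => (K.form (W (x - s n - t n)) (x - s n - t n)).re +
        2 * (K.form (W (x - s n - t n)) (t n)).re - (K.form (M x) x).re) atTop
        (𝓝 (K.form ((T - M) x) x).re) := by
      have h2 := tendsto_form_sub_sub (hlim x) e1 e2
      have h3 := (((Complex.continuous_re.tendsto _).comp h2).add
        (((Complex.continuous_re.tendsto _).comp e2).const_mul 2)).sub
        (tendsto_const_nhds (x := (K.form (M x) x).re))
      rw [Complex.zero_re, mul_zero, add_zero, ← Complex.sub_re, ← form_sub_apply] at h3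
      exact h3
    refine ge_of_tendsto' h1 fun n => ?_
    have i1 := hMmax.1.2.1.nonneg (x - s n - t n)
    have i2 : K.form (M x) x = K.form (M (x - s n - t n)) (x - s n - t n) +
        K.form (W (x - s n - t n)) (t n) + conj (K.form (W (x - s n - t n)) (t n)) +
        K.form (W (t n)) (t n) := by
      rw [← hMSm _ _ (ht n), ← hMSm _ _ (ht n), hMsa.conj_form]
      simp only [map_sub, LinearMap.sub_apply, hMSp _ _ (hs n), hMSp' _ (hs n)]
      ring
    have i3 := hneg _ (ht n)
    rw [i2]
    rw [form_sub_apply, Complex.sub_re] at i1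
    simp only [Complex.add_re, Complex.conj_re]
    linarith
  -- Only the companion of the first subspace is covered by `range_le_companion`; that of `S₋` is
  -- reached through `-W`.
  · simpa using range_neg_le h.neg.range_le_companion
  · obtain ⟨s, t, ε, C, hε, hε0, hs, ht, hp, hq, hsC, htC, hlim⟩ := h x
    have e1 := tendsto_zero_of_norm_sq_le hε hε0 hsC (fun n => hp n _ (hs n))
    have e2 := tendsto_zero_of_norm_sq_le hε hε0 htC (fun n => hq n _ (ht n))
    -- The chain is `[Yx, x] = [Y(x - t n), x - t n] ≥ [M(x - t n), x - t n] = [Mz, z] ≥ [Wz, z] - ε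
    -- n`, with `[Wz, z] → [Tx, x]`.
    have h1 : Tendsto (fun n => (K.form (Y x) x).re -
        ((K.form (W (x - s n - t n)) (x - s n - t n)).re - ε n)) atTop
        (𝓝 (K.form ((Y - T) x) x).re) := by
      have h2 := tendsto_form_sub_sub (hlim x) e1 e2
      have h3 := (tendsto_const_nhds (x := (K.form (Y x) x).re)).sub
        (((Complex.continuous_re.tendsto _).comp h2).sub hε)
      rw [sub_zero, ← Complex.sub_re, ← form_sub_apply] at h3
      exact h3
    refine ge_of_tendsto' h1 fun n => ?_
    have y1 : ∀ z, K.form (Y z) (t n) = 0 := fun z => hY.2.2 ⟨z, rfl⟩ _ (ht n)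
    have y2 : ∀ z, K.form (Y (t n)) z = 0 := fun z => by rw [← hY.1.conj_form, y1, map_zero]
    have e3 : K.form (Y (x - t n)) (x - t n) = K.form (Y x) x := by
      rw [map_sub (K.form _), y1, sub_zero, map_sub, map_sub, LinearMap.sub_apply, y2, sub_zero]
    have i1 := hY.2.1.nonneg (x - t n)
    set z := x - s n - t n with hz
    have e4 : K.form (M (x - t n)) (x - t n) = K.form (M z) z := by
      have : x - t n = z + s n := by rw [hz]; abel
      rw [this]
      simp only [map_add, LinearMap.add_apply, hMSp _ _ (hs n), hMSp' _ (hs n), add_zero]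
    rw [form_sub_apply, Complex.sub_re, e3, e4] at i1
    -- `z` is almost a minimum of the form over its translates by `S₊`: a further shift by `s'` of
    -- energy `d = [Ws', s']` changes the form by at least `d - 2√(ε n · d) ≥ -ε n`. Shifts along
    -- the Schur limit for `M` at `z` then give the bound.
    have i2 : (K.form (W z) z).re - ε n ≤ (K.form (M z) z).re := by
      obtain ⟨s', t', ε', C', hε', hε0', hs', ht', hp', hq', hsC', htC', hlim'⟩ := hlimM z
      have ht0 : ∀ n, t' n = 0 := fun n => (Submodule.mem_bot ℂ).1 (ht' n)
      simp only [ht0, sub_zero] at hp' hlim'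
      have e1' := tendsto_zero_of_norm_sq_le hε' hε0' hsC' (fun n => hp' n _ (hs' n))
      have h2 := (Complex.continuous_re.tendsto _).comp ((hlim' z).sub e1')
      rw [sub_zero] at h2
      refine ge_of_tendsto' h2 fun k => ?_
      have j1 := hp n _ (hs' k)
      have j2 := hpos _ (hs' k)
      have j3 := Complex.re_le_norm (K.form (W z) (s' k))
      have j4 : K.form (W (s' k)) z = conj (K.form (W z) (s' k)) := (hW.conj_form _ _).symm
      have j5 : (K.form (W (z - s' k)) z - K.form (W (z - s' k)) (s' k)).re =
          (K.form (W z) z).re - 2 * (K.form (W z) (s' k)).re + (K.form (W (s' k)) (s' k)).re := by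
        simp only [map_sub, LinearMap.sub_apply, j4, Complex.sub_re, Complex.conj_re]
        ring
      change _ ≤ (K.form (W (z - s' k)) z - K.form (W (z - s' k)) (s' k)).re
      rw [j5]
      have j6 : 2 * ‖K.form (W z) (s' k)‖ ≤ ε n + (K.form (W (s' k)) (s' k)).re := by
        refine abs_le_of_sq_le_sq' ?_ (add_nonneg (hε0 n) j2) |>.2
        nlinarith [sq_nonneg (ε n - (K.form (W (s' k)) (s' k)).re)]
      linarith
    linarith

end SchurLimit

/-! ### Form bounds and their independence of the signature operator. -/

section FormBound

variable {W : V →ₗ[ℂ] V}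

theorem inner_signatureMul (D : K.Decomposition) (hW : K.IsBoundedSelfAdjoint W) (x y : D.Space) :
    inner ℂ (signatureMul D hW x) y = K.form (W (D.toSpace.symm x)) (D.toSpace.symm y) :=
  (D.form_eq_inner _ _).symm

theorem isSelfAdjoint_signatureMul (D : K.Decomposition) (hW : K.IsBoundedSelfAdjoint W) :
    IsSelfAdjoint (signatureMul D hW) := by
  rw [ContinuousLinearMap.isSelfAdjoint_iff_isSymmetric]
  intro x y
  change inner ℂ (signatureMul D hW x) y = inner ℂ x (signatureMul D hW y)
  rw [← inner_conj_symm x, inner_signatureMul, inner_signatureMul, hW.conj_form]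

/-- The Cauchy–Schwarz inequality for the form of a positive operator. -/
theorem norm_form_sq_le {P : V →ₗ[ℂ] V} (hP : K.IsBoundedSelfAdjoint P)
    (h0 : ∀ x, 0 ≤ (K.form (P x) x).re) (x y : V) :
    ‖K.form (P x) y‖ ^ 2 ≤ (K.form (P x) x).re * (K.form (P y) y).re := by
  let core : PreInnerProductSpace.Core ℂ V :=
    { inner := fun x y => K.form (P x) y
      conj_inner_symm := fun x y => hP.conj_form y x
      re_inner_nonneg := h0
      add_left := fun x y z => by simp
      smul_left := fun x y r => by simp }
  have h := @InnerProductSpace.Core.inner_mul_inner_self_le ℂ V _ _ _ core x y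
  have e : ‖K.form (P y) x‖ = ‖K.form (P x) y‖ := by
    rw [← hP.conj_form, RCLike.norm_conj]
  have h' : ‖K.form (P x) y‖ * ‖K.form (P y) x‖ ≤
    (K.form (P x) x).re * (K.form (P y) y).re := h
  rwa [e, ← sq] at h'

/-- The functionals `[W x, ·]` on `M` are bounded by a multiple of `‖x‖` with respect to the
seminorm `[W m, m]^{1/2}`. -/
def FormBound (D : K.Decomposition) (W : V →ₗ[ℂ] V) (M : Submodule ℂ V) : Prop :=
  ∃ C : ℝ, ∀ x, ∀ m ∈ M, ‖K.form (W x) m‖ ^ 2 ≤ C * ‖D.toSpace x‖ ^ 2 * (K.form (W m) m).re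

theorem formBound_bot (D : K.Decomposition) (W : V →ₗ[ℂ] V) : FormBound D W ⊥ :=
  ⟨0, fun x m hm => by rw [(Submodule.mem_bot ℂ).1 hm]; simp⟩

theorem FormBound.change {D : K.Decomposition} {M : Submodule ℂ V}
    (hpos : ∀ m ∈ M, 0 ≤ (K.form (W m) m).re) (h : FormBound D W M) (D' : K.Decomposition) :
    FormBound D' W M := by
  obtain ⟨C, hC⟩ := h
  let g : D'.Space →L[ℂ] D.Space :=
    { toLinearMap := (D.toSpace : V →ₗ[ℂ] D.Space) ∘ₗ (D'.toSpace.symm : D'.Space →ₗ[ℂ] V)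
      cont := D'.continuous_change D }
  refine ⟨|C| * ‖g‖ ^ 2, fun x m hm => (hC x m hm).trans ?_⟩
  refine mul_le_mul_of_nonneg_right ?_ (hpos m hm)
  have h1 : ‖D.toSpace x‖ ≤ ‖g‖ * ‖D'.toSpace x‖ := g.le_opNorm (D'.toSpace x)
  rw [mul_assoc, ← mul_pow]
  gcongr
  exact le_abs_self C

theorem formBound_of_mem_lowerSet (D : K.Decomposition) (hW : K.IsBoundedSelfAdjoint W)
    {M : Submodule ℂ V} {X : V →ₗ[ℂ] V} (hX : X ∈ K.lowerSet W (K.companion M)) :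
    FormBound D W M := by
  have hP : K.IsBoundedSelfAdjoint (W - X) := hW.sub hX.1
  -- Against `m` in `M` the forms of `W - X` and `W` agree; Cauchy–Schwarz for `W - X` leaves the
  -- factor `[(W - X)x, x] ≤ ‖J(W - X)‖ ‖x‖²`.
  refine ⟨‖signatureMul D hP‖, fun x m hm => ?_⟩
  have hXm : ∀ z, K.form (X z) m = 0 := fun z => hX.2.2 ⟨z, rfl⟩ m hm
  have e : ∀ z, K.form ((W - X) z) m = K.form (W z) m := fun z => by
    rw [form_sub_apply, hXm, sub_zero]
  have h1 := norm_form_sq_le hP hX.2.1.nonneg x m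
  have h0 := hX.2.1.nonneg m
  rw [e, e] at h1
  rw [e] at h0
  refine h1.trans (mul_le_mul_of_nonneg_right ?_ h0)
  refine (Complex.re_le_norm _).trans ?_
  have e2 : K.form ((W - X) x) x = inner ℂ (signatureMul D hP (D.toSpace x)) (D.toSpace x) :=
    (inner_signatureMul D hP (D.toSpace x) (D.toSpace x)).symm
  rw [e2, sq, ← mul_assoc]
  refine (norm_inner_le_norm _ _).trans ?_
  gcongr
  exact (signatureMul D hP).le_opNorm _

end FormBound

/-! ### Transfer between the Krein space and its associated Hilbert spaces. -/

section SignDecomposition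

variable {W : V →ₗ[ℂ] V} {S Sp Sm : Submodule ℂ V} {D₀ : K.Decomposition}

/-- In every associated Hilbert space, the form of the modulus of the compression of `J W` to `S`
is equivalent to `[W p, p] - [W q, q]`, `p ∈ S₊`, `q ∈ S₋`. -/
theorem IsSignDecomposition.exists_abs_equiv (hdec : K.IsSignDecomposition D₀ W S Sp Sm)
    (D : K.Decomposition) (hW : K.IsBoundedSelfAdjoint W) [CompleteSpace (D.sub S)] :
    ∃ C : ℝ, 0 ≤ C ∧ ∀ p ∈ Sp, ∀ q ∈ Sm, ∀ s : D.sub S, (s : D.Space) = D.toSpace (p + q) →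
      (K.form (W p) p).re - (K.form (W q) q).re ≤
        C * ‖sqrtAbs (block11 (signatureMul D hW) (D.sub S)) s‖ ^ 2 ∧
      ‖sqrtAbs (block11 (signatureMul D hW) (D.sub S)) s‖ ^ 2 ≤
        C * ((K.form (W p) p).re - (K.form (W q) q).re) := by
  obtain ⟨C, hC0, hC⟩ := exists_abs_block11_equiv (S := D.sub S) (p := D.sub Sp) (q := D.sub Sm)
    (isSelfAdjoint_signatureMul D hW)
    (by rw [← hdec.sup_eq]; exact (Submodule.map_sup _ _ _).symm)
    (Submodule.disjoint_map D.toSpace.injective hdec.disjoint)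
    (hdec.closed_pos.isClosed D) (hdec.closed_neg.isClosed D)
    (by
      rintro _ ⟨x, hx, rfl⟩ _ ⟨y, hy, rfl⟩
      rw [inner_signatureMul]
      exact hdec.form_eq_zero x hx y hy)
    (by
      rintro _ ⟨x, hx, rfl⟩
      rw [inner_signatureMul]
      exact hdec.nonneg x hx)
    (by
      rintro _ ⟨x, hx, rfl⟩
      rw [inner_signatureMul]
      exact hdec.nonpos x hx)
  refine ⟨C, hC0, fun p hp q hq s hs => ?_⟩
  have h := hC (D.toSpace p) ⟨p, hp, rfl⟩ (D.toSpace q) ⟨q, hq, rfl⟩ s hs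
  rw [inner_signatureMul, inner_signatureMul] at h
  exact h

/-- Equivalence of the energies replaces `‖|a|^{1/2}(p + q)‖²` by `[Wp, p] - [Wq, q]`, so the bound
over `S` splits into one over each summand. -/
theorem IsSignDecomposition.isWeaklyComplFor_iff (hdec : K.IsSignDecomposition D₀ W S Sp Sm)
    (D : K.Decomposition) (hW : K.IsBoundedSelfAdjoint W) (hS : K.IsClosedSubspace S) :
    IsWeaklyComplFor D hW hS ↔ FormBound D W Sp ∧ FormBound D (-W) Sm := by
  have hc : CompleteSpace (D.sub S) := (hS.isClosed D).completeSpace_coe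
  obtain ⟨C₀, hC₀, hequiv⟩ := hdec.exists_abs_equiv D hW
  have hSp : Sp ≤ S := hdec.sup_eq ▸ le_sup_left
  have hSm : Sm ≤ S := hdec.sup_eq ▸ le_sup_right
  refine (isWeaklyCompl_iff (S := D.sub S) (isSelfAdjoint_signatureMul D hW)).trans ⟨?_, ?_⟩
  · rintro ⟨C, hC⟩
    have key : ∀ x, ∀ m (hm : m ∈ S), ‖K.form (W x) m‖ ^ 2 ≤ C ^ 2 * ‖D.toSpace x‖ ^ 2 *
        ‖sqrtAbs (block11 (signatureMul D hW) (D.sub S)) ⟨D.toSpace m, m, hm, rfl⟩‖ ^ 2 := by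
      intro x m hm
      rw [← mul_pow, ← mul_pow]
      refine pow_le_pow_left₀ (norm_nonneg _) ?_ 2
      have := hC (D.toSpace x) ⟨D.toSpace m, m, hm, rfl⟩
      rwa [inner_signatureMul] at this
    constructor
    · refine ⟨C ^ 2 * C₀, fun x m hm => (key x m (hSp hm)).trans ?_⟩
      have h1 := (hequiv m hm 0 Sm.zero_mem ⟨D.toSpace m, m, hSp hm, rfl⟩ (by simp)).2
      simp only [map_zero, Complex.zero_re, sub_zero] at h1
      calc _ ≤ C ^ 2 * ‖D.toSpace x‖ ^ 2 * (C₀ * (K.form (W m) m).re) := by gcongr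
        _ = _ := by ring
    · refine ⟨C ^ 2 * C₀, fun x m hm => ?_⟩
      have h1 := (hequiv 0 Sp.zero_mem m hm ⟨D.toSpace m, m, hSm hm, rfl⟩ (by simp)).2
      simp only [map_zero, Complex.zero_re, zero_sub] at h1
      simp only [LinearMap.neg_apply, map_neg, norm_neg, Complex.neg_re]
      refine (key x m (hSm hm)).trans ?_
      calc _ ≤ C ^ 2 * ‖D.toSpace x‖ ^ 2 * (C₀ * -(K.form (W m) m).re) := by gcongr
        _ = _ := by ring
  · rintro ⟨⟨C₁, h₁⟩, ⟨C₂, h₂⟩⟩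
    simp only [LinearMap.neg_apply, map_neg, norm_neg, Complex.neg_re] at h₂
    set C := max |C₁| |C₂| with hCdef
    -- The `2` comes from `(α + β)² ≤ 2(α² + β²)` for the parts in `S₊` and `S₋`, and `C₀` from the
    -- equivalence of energies.
    refine ⟨Real.sqrt (2 * C * C₀), ?_⟩
    intro x s
    obtain ⟨m, hm, hms⟩ := s.2
    obtain ⟨p, hp, q, hq, rfl⟩ := Submodule.mem_sup.1 (hdec.sup_eq.symm ▸ hm : m ∈ Sp ⊔ Sm)
    have h3 := (hequiv p hp q hq s hms.symm).1
    have hC0 : 0 ≤ C := (abs_nonneg _).trans (le_max_left _ _)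
    have i1 : ‖K.form (W (D.toSpace.symm x)) p‖ ^ 2 ≤ C * ‖x‖ ^ 2 * (K.form (W p) p).re := by
      refine (h₁ _ p hp).trans (mul_le_mul_of_nonneg_right ?_ (hdec.nonneg p hp))
      rw [LinearEquiv.apply_symm_apply]
      gcongr
      exact (le_abs_self _).trans (le_max_left _ _)
    have i2 : ‖K.form (W (D.toSpace.symm x)) q‖ ^ 2 ≤ C * ‖x‖ ^ 2 * -(K.form (W q) q).re := by
      refine (h₂ _ q hq).trans (mul_le_mul_of_nonneg_right ?_
        (neg_nonneg.2 (hdec.nonpos q hq)))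
      rw [LinearEquiv.apply_symm_apply]
      gcongr
      exact (le_abs_self _).trans (le_max_right _ _)
    have e : inner ℂ (signatureMul D hW x) (s : D.Space) =
        K.form (W (D.toSpace.symm x)) p + K.form (W (D.toSpace.symm x)) q := by
      rw [inner_signatureMul, ← hms, ← map_add]
      rfl
    rw [e]
    refine abs_le_of_sq_le_sq' ?_ (by positivity) |>.2
    rw [mul_pow, mul_pow, Real.sq_sqrt (by positivity)]
    have i3 := norm_add_le (K.form (W (D.toSpace.symm x)) p) (K.form (W (D.toSpace.symm x)) q)
    calc _ ≤ (‖K.form (W (D.toSpace.symm x)) p‖ + ‖K.form (W (D.toSpace.symm x)) q‖) ^ 2 := by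
          gcongr
      _ ≤ 2 * (‖K.form (W (D.toSpace.symm x)) p‖ ^ 2 +
          ‖K.form (W (D.toSpace.symm x)) q‖ ^ 2) := add_sq_le
      _ ≤ 2 * C * ‖x‖ ^ 2 * ((K.form (W p) p).re - (K.form (W q) q).re) := by linarith
      _ ≤ 2 * C * ‖x‖ ^ 2 *
          (C₀ * ‖sqrtAbs (block11 (signatureMul D hW) (D.sub S)) s‖ ^ 2) := by gcongr
      _ = _ := by ring

theorem isBounded_schurComplFor (D : K.Decomposition) (hW : K.IsBoundedSelfAdjoint W)
    (hS : K.IsClosedSubspace S) (h : IsWeaklyComplFor D hW hS) :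
    K.IsBounded (schurComplFor D hW hS h) :=
  haveI : CompleteSpace (D.sub S) := (hS.isClosed D).completeSpace_coe
  ⟨D, D.continuous_signature.comp
    (KreinSchur.schurCompl (signatureMul D hW) (D.sub S) h).continuous⟩

theorem IsSignDecomposition.isSchurLimit_schurComplFor
    (hdec : K.IsSignDecomposition D₀ W S Sp Sm) (D : K.Decomposition)
    (hW : K.IsBoundedSelfAdjoint W) (hS : K.IsClosedSubspace S)
    (h : IsWeaklyComplFor D hW hS) :
    K.IsSchurLimit W Sp Sm (schurComplFor D hW hS h) := by
  have hc : CompleteSpace (D.sub S) := (hS.isClosed D).completeSpace_coe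
  obtain ⟨C₀, hC₀, hequiv⟩ := hdec.exists_abs_equiv D hW
  have hSp : Sp ≤ S := hdec.sup_eq ▸ le_sup_left
  have hSm : Sm ≤ S := hdec.sup_eq ▸ le_sup_right
  intro x
  obtain ⟨σ, ε, C, hε, hε0, hbound, hC, hlim⟩ := exists_tendsto_schurCompl (S := D.sub S)
    (isSelfAdjoint_signatureMul D hW) h (D.toSpace x)
  have hσ : ∀ n, ∃ p ∈ Sp, ∃ q ∈ Sm, (σ n : D.Space) = D.toSpace (p + q) := by
    intro n
    obtain ⟨m, hm, hms⟩ := (σ n).2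
    obtain ⟨p, hp, q, hq, rfl⟩ := Submodule.mem_sup.1 (hdec.sup_eq.symm ▸ hm : m ∈ Sp ⊔ Sm)
    exact ⟨p, hp, q, hq, hms.symm⟩
  choose s hs t ht hst using hσ
  have hform : ∀ n y, inner ℂ (signatureMul D hW (D.toSpace x - σ n)) (D.toSpace y) =
      K.form (W (x - s n - t n)) y := by
    intro n y
    rw [hst, ← map_sub, inner_signatureMul, sub_sub]
    rfl
  have hN : ∀ n, (K.form (W (s n)) (s n)).re - (K.form (W (t n)) (t n)).re ≤ C₀ * C ^ 2 := by
    intro n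
    refine (hequiv _ (hs n) _ (ht n) _ (hst n)).1.trans ?_
    gcongr
    exact hC n
  have key : ∀ n, ∀ m (hm : m ∈ S), ‖K.form (W (x - s n - t n)) m‖ ^ 2 ≤ ε n ^ 2 *
      ‖sqrtAbs (block11 (signatureMul D hW) (D.sub S)) ⟨D.toSpace m, m, hm, rfl⟩‖ ^ 2 := by
    intro n m hm
    rw [← mul_pow, ← hform]
    exact pow_le_pow_left₀ (norm_nonneg _) (hbound n ⟨D.toSpace m, m, hm, rfl⟩) 2
  -- Squaring the Hilbert space estimate and passing to the energies of `W` turns `ε n` into `ε n ^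
  -- 2 * C₀`.
  refine ⟨s, t, fun n => ε n ^ 2 * C₀, C₀ * C ^ 2, ?_, fun n => by positivity, hs, ht,
    fun n p hp => ?_, fun n q hq => ?_, fun n => ?_, fun n => ?_, fun y => ?_⟩
  · simpa using (hε.pow 2).mul_const C₀
  · refine (key n p (hSp hp)).trans ?_
    have h1 := (hequiv p hp 0 Sm.zero_mem ⟨D.toSpace p, p, hSp hp, rfl⟩ (by simp)).2
    simp only [map_zero, Complex.zero_re, sub_zero] at h1
    rw [mul_assoc]
    gcongr
  · refine (key n q (hSm hq)).trans ?_
    have h1 := (hequiv 0 Sp.zero_mem q hq ⟨D.toSpace q, q, hSm hq, rfl⟩ (by simp)).2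
    simp only [map_zero, Complex.zero_re, zero_sub] at h1
    rw [mul_assoc]
    gcongr
  · linarith [hN n, hdec.nonpos _ (ht n)]
  · linarith [hN n, hdec.nonneg _ (hs n)]
  · have e : K.form (schurComplFor D hW hS h x) y =
        inner ℂ (schurCompl (signatureMul D hW) (D.sub S) h (D.toSpace x)) (D.toSpace y) := rfl
    rw [e]
    exact (hlim (D.toSpace y)).congr fun n => hform n y

/-- The Schur complement is the minimax operator. -/
theorem IsSignDecomposition.isMinMax_of_isSchurLimit (hdec : K.IsSignDecomposition D₀ W S Sp Sm)
    (hW : K.IsBoundedSelfAdjoint W) (hbd : FormBound D₀ W Sp) {T : V →ₗ[ℂ] V}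
    (hT : K.IsBounded T) (hlim : K.IsSchurLimit W Sp Sm T) : K.IsMinMax W Sp Sm T := by
  have hdec' := hdec.pos_bot
  have h : IsWeaklyComplFor D₀ hW hdec.closed_pos :=
    (hdec'.isWeaklyComplFor_iff D₀ hW hdec.closed_pos).2 ⟨hbd, formBound_bot _ _⟩
  exact IsSchurLimit.isMinMax hW hT (isBounded_schurComplFor D₀ hW hdec.closed_pos h)
    hdec.form_eq_zero hdec.nonneg hdec.nonpos
    (hdec'.isSchurLimit_schurComplFor D₀ hW hdec.closed_pos h) hlim

end SignDecomposition

end KreinSpace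

end KreinSchur

end

theorem theorem4p8 {V : Type*} [AddCommGroup V] [Module ℂ V] (K : KreinSchur.KreinSpace V)
    (W : V →ₗ[ℂ] V) (hW : K.IsBoundedSelfAdjoint W)
    (S : Submodule ℂ V) (hS : K.IsClosedSubspace S)
    (D : K.Decomposition) (Sp Sm : Submodule ℂ V) (hdec : K.IsSignDecomposition D W S Sp Sm) :
    (KreinSchur.KreinSpace.IsWeaklyCompl hW hS ↔
      (∃ T, K.IsMinMax W Sp Sm T) ∧ (∃ T, K.IsMaxMin W Sp Sm T)) ∧
    (KreinSchur.KreinSpace.IsWeaklyCompl hW hS →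
      ∀ D' : K.Decomposition, ∃ h : KreinSchur.KreinSpace.IsWeaklyComplFor D' hW hS,
        K.IsMinMax W Sp Sm (KreinSchur.KreinSpace.schurComplFor D' hW hS h) ∧
        K.IsMaxMin W Sp Sm (KreinSchur.KreinSpace.schurComplFor D' hW hS h)) := by
  have hneg := hdec.neg hW
  have main : KreinSchur.KreinSpace.IsWeaklyCompl hW hS →
      ∀ D' : K.Decomposition, ∃ h : KreinSchur.KreinSpace.IsWeaklyComplFor D' hW hS,
        K.IsMinMax W Sp Sm (KreinSchur.KreinSpace.schurComplFor D' hW hS h) ∧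
        K.IsMaxMin W Sp Sm (KreinSchur.KreinSpace.schurComplFor D' hW hS h) := by
    rintro ⟨D₁, h₁⟩ D'
    obtain ⟨hp, hm⟩ := (hdec.isWeaklyComplFor_iff D₁ hW hS).1 h₁
    have h : KreinSchur.KreinSpace.IsWeaklyComplFor D' hW hS :=
      (hdec.isWeaklyComplFor_iff D' hW hS).2 ⟨hp.change hdec.nonneg D', hm.change hneg.nonneg D'⟩
    have hT := KreinSchur.KreinSpace.isBounded_schurComplFor D' hW hS h
    have hlim := hdec.isSchurLimit_schurComplFor D' hW hS h
    refine ⟨h, hdec.isMinMax_of_isSchurLimit hW (hp.change hdec.nonneg D) hT hlim, ?_⟩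
    -- `-T` is a Schur limit for `-W` with the summands exchanged; negating its min-max property
    -- gives the max-min property of `T`.
    have := (hneg.isMinMax_of_isSchurLimit hW.neg (hm.change hneg.nonneg D) hT.neg hlim.neg).neg
    rwa [neg_neg, neg_neg] at this
  refine ⟨⟨fun h => ?_, ?_⟩, main⟩
  · obtain ⟨h', hmin, hmax⟩ := main h D
    exact ⟨⟨_, hmin⟩, ⟨_, hmax⟩⟩
  -- The inner extrema suffice, and only through membership: an element of each of the two inner
  -- sets already gives a form bound.
  · rintro ⟨⟨_, M, hM, -⟩, ⟨_, M', hM', -⟩⟩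
    exact ⟨D, (hdec.isWeaklyComplFor_iff D hW hS).2
      ⟨KreinSchur.KreinSpace.formBound_of_mem_lowerSet D hW hM.1,
        KreinSchur.KreinSpace.formBound_of_mem_lowerSet D hW.neg
          (KreinSchur.KreinSpace.neg_mem_lowerSet hM'.1)⟩⟩
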